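/- Let $G$ be a finite directed graph with positive edge weights and $n$ vertices, let $s\in V(G)$ and $\epsilon\in(0,1]$, and put $\epsilon_1=\epsilon/(3\log_2 n)$, $\epsilon_2=\epsilon_1/(2\log_2 n)$ (these are not used if $n\le 6$). All distances are $\infty$ if there is no path, and $H-x$ is $H$ with the vertex $x$ and its edges removed. **Construction.** An oracle for a graph $H$ with source $s$ is built recursively. * Take a shortest path tree $T$ of $H$ rooted at $s$ (spanning the vertices reachable from $s$). If $|V(T)|\le 6$, stop (leaf). * Otherwise choose a centroid $z$ of $T$ (every component of $T-z$ has at most $|V(T)|/2$ vertices) and split $T$ at $z$ into subtrees $T_1\ni s$ and $T_2$ (rooted at $z$) with $V(T_1)\cup V(T_2)=V(T)$, $V(T_1)\cap V(T_2)=\{z\}$, every edge of $T$ in exactly one of them, and $|V(T)|/3\le|V(T_k)|\le(2|V(T)|+1)/3$ for $k=1,2$. Let $P=\langle v_0,\dots,v_{p-1}\rangle$ be the path of $T$ from $s$ to $z$, and $L=\lceil\log_2 p\rceil$. For $0\le i\le L$ and $0\le j<2^i$ let $I^i_j=\{v_k: j2^{L-i}\le k<(j+1)2^{L-i},\ k<p\}$.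 * For each $i\le L$ run the progressive Dijkstra algorithm. It keeps $d[v]$, $b[v]$ and a list $\mathsf{upd}(i,v)$; initially $d[v]=\infty$ and the lists are empty. In phase $j=0,1,\dots,2^i-1$ use the graph $H_{i,j}$ obtained from $H$ by removing the edges of $P$, all edges into $I^i_0\cup\dots\cup I^i_j$ and all edges out of $\bigcup_{j'>j}I^i_{j'}$, and adding a source $s'$ with edges $(s',u)$ of weight $\mathsf{dist}_P(s,u)$ for $u\in I^i_j$. Set $d[u]\gets\infty$, $b[u]\gets u$ for $u\in I^i_j$, $d[s']\gets0$, and put $s'$ alone in a heap. While the heap is non-empty, extract a vertex $u$ of minimum $d[u]$; for each out-neighbour $v$ of $u$, with $c=d[u]+w(u,v)$: if $v$ is in the heap and $c<d[v]$, or $v$ is not in the heap and $c<d[v]/(1+\epsilon_2)$, then set $d[v]\gets c$, set $b[v]\gets b[u]$ unless $u=s'$, put $v$ in the heap, and make $(j,d[v],b[v])$ the entry of $\mathsf{upd}(i,v)$ with index $j$. * Store values $\hat d(x)$ with $\mathsf{dist}_{H-x}(s,z)\le\hat d(x)\le(1+\epsilon_1)\,\mathsf{dist}_{H-x}(s,z)$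 for all $x\in V(H)\setminus\{s\}$, as output by a $(1+\epsilon_1)$-approximate $s$-$z$ replacement path subroutine. * Recurse, with the same $\epsilon_1,\epsilon_2$ and source $s$, on $H_1$ and $H_2$. The graph $H_1$ is $H[V(T_1)]$ with added edges $(z,u)$, $u\in V(T_1)$, of weight the distance from $z$ to $u$ in the graph of the edges of $H$ incident to $V(T_2)$ (if finite), and edges $(b,v)$ of weight $\ell-\mathsf{dist}_T(s,b)$ for each $v\in V(P)$, $i\le L$ and $(j,\ell,b)\in\mathsf{upd}(i,v)$; loops are omitted and of parallel edges the lightest is kept. The graph $H_2$ is $H[V(T_2)\setminus\{z\}]$ with $s$ and the edges $(s,u)$, $u\in V(T_2)\setminus\{z\}$, of weight the distance from $s$ to $u$ in the graph of the edges of $H$ incident to $V(T_1)$ (if finite). **Query.** For $x=v_f\in V(P)$ let $\mathsf{dp}(x,t)$ be the minimum over $0\le i\le L$ of the value $\ell$ of the last entry of $\mathsf{upd}(i,t)$ with index smaller than the $j$ with $v_f\in I^i_j$ ($\infty$ if there is none); for $x\notin V(P)$ let $\mathsf{dp}(x,t)=\infty$. Then $\mathsf{query}_H(x,t)$ is given by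 the first case that applies: 1. $x$ is not an ancestor of $t$ in $T$ (each vertex being an ancestor of itself): $\mathsf{dist}_T(s,t)$; 2. leaf: $\mathsf{dist}_{H-x}(s,t)$; 3. $x\in V(P)$ and $t\in V(H_2)$: $\min(\mathsf{dp}(x,t),\ \hat d(x)+\mathsf{dist}_T(z,t))$; 4. $x,t\in V(H_1)$: $\min(\mathsf{query}_{H_1}(x,t),\ \mathsf{dp}(x,t))$; 5. $x,t\in V(H_2)$: $\mathsf{query}_{H_2}(x,t)$. **Lemma.** The construction can be carried out for $G$ and $s$. However its free choices (trees, bipartitions, ties, values $\hat d$) are made, for every failed vertex $x\in V(G)\setminus\{s\}$ and every target $t\in V(G)\setminus\{x\}$, $$\mathsf{dist}_{G-x}(s,t)\ \le\ \mathsf{query}_G(x,t)\ \le\ (1+\epsilon)\,\mathsf{dist}_{G-x}(s,t).$$ -/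

import Mathlib

open scoped ENNReal Classical

noncomputable section

namespace FaultOracle

universe u

/-- A finite weighted directed graph whose vertices are named by elements of `V`.  The weight `⊤`
means that there is no edge; `w` is only looked at on pairs of vertices of the graph. -/
structure WDigraph (V : Type u) where
  verts : Finset V
  w : V → V → ℝ≥0∞

namespace WDigraph

variable {V : Type u} [DecidableEq V]

/-- `(u, v)` is an edge of `H`. -/
def Adj (H : WDigraph V) (u v : V) : Prop := u ∈ H.verts ∧ v ∈ H.verts ∧ H.w u v ≠ ⊤

/-- `A = ⟨a₀, …, a_{k-1}⟩` is a (simple) path of `H` from `u` to `v`. -/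
def IsPath (H : WDigraph V) (u v : V) (A : List V) : Prop :=
  A.head? = some u ∧ A.getLast? = some v ∧ A.Nodup ∧ (∀ a ∈ A, a ∈ H.verts) ∧ A.IsChain H.Adj

/-- The weighted length of a sequence of vertices. -/
def len (H : WDigraph V) : List V → ℝ≥0∞
  | [] => 0
  | [_] => 0
  | a :: b :: l => H.w a b + len H (b :: l)

/-- The length of a shortest path from `u` to `v` in `H`; it is `⊤` if there is no such path, in
particular if `u` or `v` is not a vertex of `H`. -/
def dist (H : WDigraph V) (u v : V) : ℝ≥0∞ :=
  ⨅ (A : List V) (_ : H.IsPath u v A), H.len A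

/-- `H - x`. -/
def del (H : WDigraph V) (x : V) : WDigraph V := ⟨H.verts.erase x, H.w⟩

/-- The graph formed by the edges of `H` with at least one endpoint in `U`. (Isolated vertices are
kept; they do not matter for distances between distinct vertices.) -/
def incident (H : WDigraph V) (U : Finset V) : WDigraph V :=
  ⟨H.verts, fun u v => if u ∈ U ∨ v ∈ U then H.w u v else ⊤⟩

end WDigraph

/-- A finite rooted tree, given by its parent map (the parent of the root is the root). -/
structure RootedTree (V : Type u) where
  verts : Finset V
  root : V
  parent : V → V
  root_mem : root ∈ verts
  parent_mem : ∀ v ∈ verts, parent v ∈ verts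
  parent_root : parent root = root
  reaches_root : ∀ v ∈ verts, ∃ k : ℕ, parent^[k] v = root

namespace RootedTree

variable {V : Type u} [DecidableEq V]

/-- The tree as a directed graph: the edges `(parent v, v)` with their weights in `G`. -/
def toDigraph (T : RootedTree V) (G : WDigraph V) : WDigraph V :=
  ⟨T.verts, fun u v => if v ≠ T.root ∧ T.parent v = u then G.w u v else ⊤⟩

/-- Distances in the tree, with the edge weights of `G`. -/
def dist (T : RootedTree V) (G : WDigraph V) (u v : V) : ℝ≥0∞ := (T.toDigraph G).dist u v

/-- `x` is an ancestor of `t` in `T`; every vertex of `T` is an ancestor of itself. -/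
def IsAncestor (T : RootedTree V) (x t : V) : Prop := t ∈ T.verts ∧ ∃ k : ℕ, T.parent^[k] t = x

/-- The number of edges from the root to `v`. -/
def depth (T : RootedTree V) (v : V) : ℕ := sInf {k : ℕ | T.parent^[k] v = T.root}

/-- The vertices of the tree path from the root to `v`, in this order. -/
def rootPath (T : RootedTree V) (v : V) : List V :=
  (List.range (T.depth v + 1)).map fun k => T.parent^[T.depth v - k] v

/-- `T` is a shortest path tree of `G` rooted at `s`: it consists of edges of `G`, spans the vertices
reachable from `s`, and its paths from the root are shortest paths of `G`. -/
structure IsShortestPathTree (T : RootedTree V) (G : WDigraph V) (s : V) : Prop where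
  root_eq : T.root = s
  mem_verts : ∀ v, v ∈ T.verts ↔ v ∈ G.verts ∧ G.dist s v ≠ ⊤
  adj : ∀ v ∈ T.verts, v ≠ s → G.Adj (T.parent v) v
  dist_eq : ∀ v ∈ T.verts, T.dist G s v = G.dist s v

/-- The underlying undirected forest of `T - z`. -/
def forest (T : RootedTree V) (z : V) : SimpleGraph V :=
  SimpleGraph.fromRel fun u v =>
    u ∈ T.verts.erase z ∧ v ∈ T.verts.erase z ∧ v ≠ T.root ∧ T.parent v = u

/-- `z` is a centroid of `T`: every component of `T - z` has at most half of the vertices. -/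
def IsCentroid (T : RootedTree V) (z : V) : Prop :=
  z ∈ T.verts ∧ ∀ v ∈ T.verts.erase z,
    2 * ((T.verts.erase z).filter fun u => (T.forest z).Reachable v u).card ≤ T.verts.card

/-- `A` and `B` are the vertex sets of the two subtrees `T₁` and `T₂` of a centroid bipartition of
`T` at `z`; `T₁` contains the root, and `T₂` is rooted at `z`.  (That the two subtrees are connected
and edge-disjoint follows from `union`, `inter` and `edges`.) -/
structure IsCentroidBipartition (T : RootedTree V) (z : V) (A B : Finset V) : Prop where
  centroid : T.IsCentroid z
  union : A ∪ B = T.verts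
  inter : A ∩ B = {z}
  edges : ∀ v ∈ T.verts, v ≠ T.root → (T.parent v ∈ A ∧ v ∈ A) ∨ (T.parent v ∈ B ∧ v ∈ B)
  root_mem : T.root ∈ A
  left_lower : T.verts.card ≤ 3 * A.card
  left_upper : 3 * A.card ≤ 2 * T.verts.card + 1
  right_lower : T.verts.card ≤ 3 * B.card
  right_upper : 3 * B.card ≤ 2 * T.verts.card + 1

end RootedTree

section ProgressiveDijkstra

variable {V : Type u} [DecidableEq V]

/-- The number of levels of the dyadic subdivision of a path with `p` vertices: `p` is padded to the
power `2 ^ levels P` of two. -/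
def levels (P : List V) : ℕ := Nat.clog 2 P.length

/-- The index of the interval of level `i` that contains the `k`-th vertex of `P`; each interval of
level `i` has `2 ^ (levels P - i)` positions. -/
def intervalIndex (P : List V) (i k : ℕ) : ℕ := k / 2 ^ (levels P - i)

/-- `v` is a vertex of the `j`-th interval of level `i` of `P`. -/
def InInterval (P : List V) (i j : ℕ) (v : V) : Prop :=
  v ∈ P ∧ intervalIndex P i (P.idxOf v) = j

/-- `(u, v)` is an edge of the path `P`. -/
def IsPathEdge (P : List V) (u v : V) : Prop := ∃ k : ℕ, P[k]? = some u ∧ P[k + 1]? = some v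

/-- The auxiliary graph `G_{i,j}`, with the new source `s' = none`: the edges of `P`, the edges
into the intervals `0, …, j` and the edges out of the intervals after the `j`-th are removed, and
`s'` gets an edge to each vertex `u` of the `j`-th interval, of weight the distance from the root to
`u` along `P` (a path of `T` from the root). -/
def phaseGraph (G : WDigraph V) (T : RootedTree V) (P : List V) (i j : ℕ) :
    WDigraph (Option V) where
  verts := insert none (G.verts.image some)
  w
    | none, some u => if InInterval P i j u then T.dist G T.root u else ⊤
    | some u, some v =>
        if IsPathEdge P u v ∨ (∃ j' ≤ j, InInterval P i j' v) ∨ (∃ j' > j, InInterval P i j' u)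
        then ⊤ else G.w u v
    | _, none => ⊤

/-- The state of the progressive Dijkstra algorithm: tentative distances `d`, branching vertices `b`
(`none` if not yet set), the contents of the heap, and the lists `upd`.  The list `upd v` has at most
one entry `(j, ℓ, b)` for each `j`; it is stored as the partial map `j ↦ (ℓ, b)`. -/
structure PDState (V : Type u) where
  d : Option V → ℝ≥0∞
  b : Option V → Option V
  heap : Finset (Option V)
  upd : Option V → ℕ → Option (ℝ≥0∞ × Option V)

/-- The vertex `v` in the heap has its key decreased when `u` is processed. -/
def Decreases (H : WDigraph (Option V)) (S : PDState V) (u v : Option V) : Prop :=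
  H.Adj u v ∧ S.d u + H.w u v < S.d v ∧ v ∈ S.heap

/-- The vertex `v` becomes active, and enters the heap, when `u` is processed. -/
def Activates (H : WDigraph (Option V)) (ε₂ : ℝ) (S : PDState V) (u v : Option V) : Prop :=
  H.Adj u v ∧ S.d u + H.w u v < S.d v / ENNReal.ofReal (1 + ε₂) ∧ v ∉ S.heap

/-- The loop over the out-neighbours `v` of the extracted vertex `u`, in phase `j`. -/
def scan (H : WDigraph (Option V)) (ε₂ : ℝ) (j : ℕ) (u : Option V) (S : PDState V) : PDState V :=
  let changed : Option V → Prop := fun v => Decreases H S u v ∨ Activates H ε₂ S u v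
  let b' : Option V → Option V := fun v => if changed v ∧ u ≠ none then S.b u else S.b v
  { d := fun v => if changed v then S.d u + H.w u v else S.d v
    b := b'
    heap := S.heap ∪ H.verts.filter (Activates H ε₂ S u)
    upd := fun v => if changed v then
        Function.update (S.upd v) j (some (S.d u + H.w u v, b' v)) else S.upd v }

/-- One iteration of the while loop: extract a vertex of minimum key (ties are broken arbitrarily) and
scan its out-neighbours. -/
def PDStep (H : WDigraph (Option V)) (ε₂ : ℝ) (j : ℕ) (S S' : PDState V) : Prop :=
  ∃ u ∈ S.heap, (∀ v ∈ S.heap, S.d u ≤ S.d v) ∧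
    S' = scan H ε₂ j u { S with heap := S.heap.erase u }

/-- The initialisation of phase `j` of level `i`. -/
def phaseStart (P : List V) (i j : ℕ) (S : PDState V) : PDState V where
  d
    | none => 0
    | some v => if InInterval P i j v then ⊤ else S.d (some v)
  b
    | none => S.b none
    | some v => if InInterval P i j v then some v else S.b (some v)
  heap := {none}
  upd := S.upd

/-- Phase `j` of level `i` can lead from the state `S` to the state `S'`. -/
def PDPhase (G : WDigraph V) (T : RootedTree V) (P : List V) (ε₂ : ℝ) (i j : ℕ)
    (S S' : PDState V) : Prop :=
  Relation.ReflTransGen (PDStep (phaseGraph G T P i j) ε₂ j) (phaseStart P i j S) S' ∧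
    S'.heap = ∅

/-- The state before phase `0`. -/
def PDState.init : PDState V := ⟨fun _ => ⊤, fun _ => none, ∅, fun _ _ => none⟩

/-- `U` is the family of lists `upd` that (a run of) the progressive Dijkstra algorithm for level `i`
outputs. -/
def IsProgMainOutput (G : WDigraph V) (T : RootedTree V) (P : List V) (ε₂ : ℝ) (i : ℕ)
    (U : Option V → ℕ → Option (ℝ≥0∞ × Option V)) : Prop :=
  ∃ S : ℕ → PDState V, S 0 = PDState.init ∧
    (∀ j < 2 ^ i, PDPhase G T P ε₂ i j (S j) (S (j + 1))) ∧ (S (2 ^ i)).upd = U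

/-- The value of the last entry with index less than `k`, and `⊤` if there is none: this is the
tentative distance after the first `k` phases, read off from a list `upd`. -/
def valueBefore (e : ℕ → Option (ℝ≥0∞ × Option V)) : ℕ → ℝ≥0∞
  | 0 => ⊤
  | k + 1 => match e k with
    | some q => q.1
    | none => valueBefore e k

/-- The query of the DP-oracle: for the failed vertex `x = v_f` on `P`, the minimum over the levels of
the tentative distance just before the phase of the interval of `x`.  It only supports `x ∈ P` and
does not contribute (value `⊤`) otherwise. -/
def dpQuery (P : List V) (upd : ℕ → Option V → ℕ → Option (ℝ≥0∞ × Option V)) (x t : V) : ℝ≥0∞ :=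
  if x ∈ P then
    (Finset.range (levels P + 1)).inf fun i =>
      valueBefore (upd i (some t)) (intervalIndex P i (P.idxOf x))
  else ⊤

/-- The query of the `P`-faulty oracle, where `dhat x` approximates the distance from `s` to `z` after
the failure of `x`. -/
def pfQuery (G : WDigraph V) (T : RootedTree V) (P : List V) (z : V)
    (upd : ℕ → Option V → ℕ → Option (ℝ≥0∞ × Option V)) (dhat : V → ℝ≥0∞) (x t : V) : ℝ≥0∞ :=
  min (dpQuery P upd x t) (dhat x + T.dist G z t)

/-- `dhat` is a possible output of a `(1 + ε₁)`-approximate replacement path computation from `s`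
to `z` in `G`. -/
def IsApproxReplacement (G : WDigraph V) (s z : V) (ε₁ : ℝ) (dhat : V → ℝ≥0∞) : Prop :=
  ∀ x ∈ G.verts, x ≠ s →
    (G.del x).dist s z ≤ dhat x ∧ dhat x ≤ ENNReal.ofReal (1 + ε₁) * (G.del x).dist s z

/-- The weights of the edges `F₁` (loops are omitted). -/
def weightF₁ (G : WDigraph V) (z : V) (B : Finset V) (u v : V) : ℝ≥0∞ :=
  if u = z ∧ v ≠ z then (G.incident B).dist z v else ⊤

/-- The weights of the edges `F₂` (loops are omitted): for each `v` on `P` and each entry `(·, ℓ, u)`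
of a list `upd(i, v)`, an edge `(u, v)` of weight `ℓ - dist_T(s, u)`. Of parallel edges the one of
smallest weight is kept. -/
def weightF₂ (G : WDigraph V) (T : RootedTree V) (P : List V)
    (upd : ℕ → Option V → ℕ → Option (ℝ≥0∞ × Option V)) (u v : V) : ℝ≥0∞ :=
  if v ∈ P ∧ u ≠ v then
    ⨅ (i : ℕ) (_ : i ≤ levels P) (j : ℕ) (ℓ : ℝ≥0∞) (_ : upd i (some v) j = some (ℓ, some u)),
      ℓ - T.dist G T.root u
  else ⊤

/-- The graph `G₁ = G[V(T₁)] + F₁ + F₂`; of parallel edges the one of smallest weight is kept. -/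
def graph₁ (G : WDigraph V) (T : RootedTree V) (z : V) (A B : Finset V)
    (upd : ℕ → Option V → ℕ → Option (ℝ≥0∞ × Option V)) : WDigraph V :=
  ⟨A, fun u v =>
    min (G.w u v) (min (weightF₁ G z B u v) (weightF₂ G T (T.rootPath z) upd u v))⟩

/-- The graph `G₂`: `G[V(T₂) \ {z}]` with the source `s` and edges `(s, v)` of weight the distance
from `s` to `v` in the graph of the edges incident to `V(T₁)`. -/
def graph₂ (G : WDigraph V) (s z : V) (A B : Finset V) : WDigraph V :=
  ⟨insert s (B.erase z), fun u v =>
    if v = s then ⊤ else if u = s then (G.incident A).dist s v else G.w u v⟩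

end ProgressiveDijkstra

/-- The data structures that the recursive construction can produce for the graph `G` and the source
`s`, with parameters `ε₁` and `ε₂`.  The choices that the construction leaves open (the shortest path
tree, the centroid bipartition, ties in the heap, the output of the approximate replacement path
subroutine) are arbitrary. -/
inductive Oracle {V : Type u} [DecidableEq V] (s : V) (ε₁ ε₂ : ℝ) : WDigraph V → Type u
  | leaf (G : WDigraph V) (T : RootedTree V) (hT : T.IsShortestPathTree G s)
      (hsize : T.verts.card ≤ 6) : Oracle s ε₁ ε₂ G
  | node (G : WDigraph V) (T : RootedTree V) (hT : T.IsShortestPathTree G s)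
      (hsize : 6 < T.verts.card)
      (z : V) (A B : Finset V) (hAB : T.IsCentroidBipartition z A B)
      (upd : ℕ → Option V → ℕ → Option (ℝ≥0∞ × Option V))
      (hupd : ∀ i ≤ levels (T.rootPath z), IsProgMainOutput G T (T.rootPath z) ε₂ i (upd i))
      (dhat : V → ℝ≥0∞) (hdhat : IsApproxReplacement G s z ε₁ dhat)
      (O₁ : Oracle s ε₁ ε₂ (graph₁ G T z A B upd))
      (O₂ : Oracle s ε₁ ε₂ (graph₂ G s z A B)) : Oracle s ε₁ ε₂ G

/-- The recursive query for the failed vertex `x` and the target `t`.  (If `x` is an ancestor of `t`,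
one of the cases of a recursive node applies, so the last value is never used.) -/
def Oracle.query {V : Type u} [DecidableEq V] {s : V} {ε₁ ε₂ : ℝ} {G : WDigraph V}
    (O : Oracle s ε₁ ε₂ G) (x t : V) : ℝ≥0∞ :=
  match O with
  | .leaf G T _ _ =>
      if ¬ T.IsAncestor x t then T.dist G s t else (G.del x).dist s t
  | .node G T _ _ z A B _ upd _ dhat _ O₁ O₂ =>
      if ¬ T.IsAncestor x t then T.dist G s t
      else if x ∈ T.rootPath z ∧ t ∈ (graph₂ G s z A B).verts then
        pfQuery G T (T.rootPath z) z upd dhat x t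
      else if x ∈ (graph₁ G T z A B upd).verts ∧ t ∈ (graph₁ G T z A B upd).verts then
        min (O₁.query x t) (dpQuery (T.rootPath z) upd x t)
      else if x ∈ (graph₂ G s z A B).verts ∧ t ∈ (graph₂ G s z A B).verts then O₂.query x t
      else ⊤

end FaultOracle

end

/-!
The error of the query can be bounded node by node of the recursion. Let `G` be the graph of a node,
`T` its shortest path tree and `P` the tree path to the centroid `z`, and let `x` be a proper ancestor
of `t`. Then `x` and `t` are both in `T₁`, or both below `z` in `T₂`, or `x` is on `P` and `t` is
below `z` in `T₂`.

*Walks through `x` in the weights of the recursive graphs.* The new edges of `G₁` and `G₂` stand for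
walks of `G` that may pass through `x`. They do no harm: the vertex after the last visit to `x` can be
reached along `T`, at least as fast and without `x` (`dist_del_le_of_subgraph`). Hence `G₁ - x` and
`G₂ - x` do not underestimate the distances of `G - x` (`dist_del_le_dist_graph₁`,
`dist_del_le_dist_graph₂`).

*Replacement paths.* If `x` is not on `P`, a walk of `G - x` can be made to visit the other subtree
only in one initial excursion along `T`, which the new edges encode exactly (`dist_graph₁_le`,
`dist_graph₂_le`). If `x` is on `P`, a replacement path follows `P` to some `b` before `x`, makes a
detour off `P`, and then either ends or returns to `P` at some `y` after `x`
(`walk_del_decomposition`). In the first case the DP-oracle knows its length approximately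
(`dpQuery_le`). In the second case it can be assumed to pass through `z` if `t` is below `z` in `T₂`,
so that `dhat x` serves; and if `t` is in `T₁`, the lists of `y` provide an edge of `G₁` that replaces
the detour (`dist_graph₁_le_of_detour`).

*The DP-oracle.* Blocking a relaxation that gains less than a factor `1 + ε₂` could make errors
accumulate over the phases. The levels prevent this (`exists_valueBefore_le`). At the level where `b`
and `x` are in sibling intervals, the phase of `b` is the last one before that of `x`. If it is blocked
at a vertex, the value there comes from a detour that starts in an earlier interval, and this detour,
continued to the target, is handled by a coarser level. So the error is at most one factor `1 + ε₂` for
each of the `⌈log₂ p⌉` levels, which is at most `1 + ε₁` in total.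

*The recursion.* Each node costs a factor `1 + ε₁`, and two levels of the recursion halve the number of
vertices, reduced by one; so there are at most `2 log₂ n` levels above the leaves
(`Oracle.query_bounds`).
-/

namespace FaultOracle

universe u

section

/-! ### Walks and distances -/

namespace WDigraph

variable {V : Type u}

/-- `H.Walk u v ℓ`: there is a walk of `H` from `u` to `v`, not necessarily simple, of length `ℓ`. -/
inductive Walk (H : WDigraph V) (u : V) : V → ℝ≥0∞ → Prop
  | nil : u ∈ H.verts → Walk H u u 0
  | snoc {v w : V} {ℓ : ℝ≥0∞} : Walk H u v ℓ → H.Adj v w → Walk H u w (ℓ + H.w v w)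

theorem Walk.mem_left {H : WDigraph V} {u v : V} {ℓ : ℝ≥0∞} (h : H.Walk u v ℓ) : u ∈ H.verts := by
  induction h with
  | nil h => exact h
  | snoc _ _ ih => exact ih

theorem Walk.mem_right {H : WDigraph V} {u v : V} {ℓ : ℝ≥0∞} (h : H.Walk u v ℓ) : v ∈ H.verts := by
  cases h with
  | nil h => exact h
  | snoc _ h => exact h.2.1

theorem Walk.ne_top {H : WDigraph V} {u v : V} {ℓ : ℝ≥0∞} (h : H.Walk u v ℓ) : ℓ ≠ ⊤ := by
  induction h with
  | nil => exact ENNReal.zero_ne_top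
  | snoc _ h ih => exact ENNReal.add_ne_top.2 ⟨ih, h.2.2⟩

theorem Walk.trans {H : WDigraph V} {u v w : V} {ℓ ℓ' : ℝ≥0∞} (h : H.Walk u v ℓ)
    (h' : H.Walk v w ℓ') : H.Walk u w (ℓ + ℓ') := by
  induction h' with
  | nil => simpa using h
  | snoc _ ha ih => rw [← add_assoc]; exact ih.snoc ha

theorem len_append_singleton (H : WDigraph V) (A : List V) (v w : V) (h : A.getLast? = some v) :
    H.len (A ++ [w]) = H.len A + H.w v w := by
  induction A with
  | nil => simp at h
  | cons a l ih =>
    cases l with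
    | nil =>
      simp at h
      subst h
      simp [len]
    | cons b l =>
      have := ih (by simpa using h)
      simp only [List.cons_append, len] at this ⊢
      rw [this, add_assoc]

theorem len_le_append (H : WDigraph V) (A B : List V) : H.len A ≤ H.len (A ++ B) := by
  induction A with
  | nil => simp [len]
  | cons a l ih =>
    cases l with
    | nil => simp [len]
    | cons b l =>
      simp only [List.cons_append, len] at ih ⊢
      gcongr

theorem IsPath.ne_nil {H : WDigraph V} {u v : V} {A : List V} (h : H.IsPath u v A) : A ≠ [] := by
  rintro rfl
  simpa using h.1

/-- The last edge of a path that does not consist of a single vertex. -/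
theorem IsPath.eq_or_exists_append {H : WDigraph V} {u v : V} {A : List V} (h : H.IsPath u v A) :
    (u = v ∧ A = [u]) ∨
      ∃ B y, A = B ++ [v] ∧ H.IsPath u y B ∧ H.Adj y v ∧ H.len A = H.len B + H.w y v := by
  obtain ⟨h1, h2, h3, h4, h5⟩ := h
  rcases List.eq_nil_or_concat A with rfl | ⟨B, c, rfl⟩
  · simp at h1
  have hc : c = v := by simpa using h2
  subst hc
  rcases List.eq_nil_or_concat B with rfl | ⟨C, y, rfl⟩
  · left
    simp at h1
    simp [h1]
  right
  have hl : (C.concat y).getLast? = some y := by simp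
  refine ⟨C.concat y, y, List.concat_eq_append, ⟨?_, hl, ?_, fun a ha => h4 a ?_, ?_⟩, ?_, ?_⟩
  · rw [List.concat_eq_append] at h1
    rwa [List.head?_append_of_ne_nil _ (by simp)] at h1
  · exact (List.nodup_append.1 (by simpa using h3)).1
  · simp only [List.concat_eq_append, List.mem_append] at ha ⊢
    exact Or.inl ha
  · rw [List.concat_eq_append, List.isChain_append] at h5
    exact h5.1
  · rw [List.concat_eq_append, List.isChain_append] at h5
    exact h5.2.2 y (by simp) c (by simp)
  · rw [List.concat_eq_append, len_append_singleton H _ y c hl]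

theorem IsPath.walk {H : WDigraph V} {u : V} :
    ∀ (n : ℕ) {A : List V} {v : V}, A.length = n → H.IsPath u v A → H.Walk u v (H.len A) := by
  intro n
  induction n with
  | zero =>
    intro A v hn h
    exact absurd (List.length_eq_zero_iff.1 hn) h.ne_nil
  | succ n ih =>
    intro A v hn h
    rcases h.eq_or_exists_append with ⟨rfl, rfl⟩ | ⟨B, y, rfl, hB, ha, hl⟩
    · exact Walk.nil (h.2.2.2.1 _ (by simp))
    · rw [hl]
      exact (ih (by simpa using hn) hB).snoc ha

theorem Walk.exists_isPath {H : WDigraph V} {u v : V} {ℓ : ℝ≥0∞} (h : H.Walk u v ℓ) :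
    ∃ A, H.IsPath u v A ∧ H.len A ≤ ℓ := by
  induction h with
  | nil h => exact ⟨[u], ⟨rfl, rfl, by simp, by simpa using h, by simp⟩, by simp [len]⟩
  | @snoc v w ℓ hw ha ih =>
    obtain ⟨A, ⟨h1, h2, h3, h4, h5⟩, hl⟩ := ih
    by_cases hwA : w ∈ A
    · obtain ⟨B, C, rfl⟩ := List.append_of_mem hwA
      have e : B ++ w :: C = (B ++ [w]) ++ C := by simp
      rw [e] at h1 h3 h4 h5 hl
      refine ⟨B ++ [w], ⟨?_, by simp, (List.nodup_append.1 h3).1,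
        fun a ha' => h4 a (List.mem_append_left _ ha'), (List.isChain_append.1 h5).1⟩, ?_⟩
      · rwa [List.head?_append_of_ne_nil _ (by simp)] at h1
      · exact (len_le_append H _ C).trans (hl.trans le_self_add)
    · have hne : A ≠ [] := by rintro rfl; simp at h1
      refine ⟨A ++ [w], ⟨?_, by simp, ?_, ?_, ?_⟩, ?_⟩
      · rwa [List.head?_append_of_ne_nil _ hne]
      · rw [List.nodup_append]
        refine ⟨h3, by simp, ?_⟩
        rintro a ha' b hb rfl
        simp at hb
        exact hwA (hb ▸ ha')
      · intro a ha'
        rcases List.mem_append.1 ha' with h | h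
        · exact h4 a h
        · simp at h
          exact h ▸ ha.2.1
      · rw [List.isChain_append]
        refine ⟨h5, by simp, ?_⟩
        intro a ha' b hb
        rw [h2] at ha'
        simp at ha' hb
        subst ha' hb
        exact ha
      · rw [len_append_singleton H A v w h2]
        gcongr

theorem dist_le_of_walk {H : WDigraph V} {u v : V} {ℓ : ℝ≥0∞} (h : H.Walk u v ℓ) :
    H.dist u v ≤ ℓ := by
  obtain ⟨A, hA, hl⟩ := h.exists_isPath
  exact (iInf₂_le A hA).trans hl

theorem finite_isPath (H : WDigraph V) (u v : V) : {A | H.IsPath u v A}.Finite := by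
  refine ((H.verts.powerset.biUnion fun s => s.val.lists.toFinset).finite_toSet).subset ?_
  intro A hA
  simp only [Finset.coe_biUnion, Set.mem_iUnion, Finset.mem_coe, Finset.mem_powerset,
    Multiset.mem_toFinset, Multiset.mem_lists_iff]
  refine ⟨A.toFinset, fun a ha => hA.2.2.2.1 a (by simpa using ha), ?_⟩
  rw [List.toFinset_val, hA.2.2.1.dedup]
  rfl

/-- The infimum defining the distance is attained. -/
theorem exists_isPath_len_eq_dist {H : WDigraph V} {u v : V} (h : H.dist u v ≠ ⊤) :
    ∃ A, H.IsPath u v A ∧ H.len A = H.dist u v := by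
  have hne : {A | H.IsPath u v A}.Nonempty := by
    by_contra hc
    apply h
    rw [dist, iInf₂_eq_top]
    intro A hA
    exact absurd ⟨A, hA⟩ hc
  obtain ⟨A, hA, hmin⟩ := Set.exists_min_image _ H.len (H.finite_isPath u v) hne
  exact ⟨A, hA, le_antisymm (le_iInf₂ hmin) (iInf₂_le A hA)⟩

theorem walk_dist {H : WDigraph V} {u v : V} (h : H.dist u v ≠ ⊤) : H.Walk u v (H.dist u v) := by
  obtain ⟨A, hA, he⟩ := exists_isPath_len_eq_dist h
  rw [← he]
  exact hA.walk _ rfl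

theorem dist_self {H : WDigraph V} {u : V} (h : u ∈ H.verts) : H.dist u u = 0 :=
  le_antisymm (dist_le_of_walk (Walk.nil h)) zero_le

theorem mem_left_of_dist_ne_top {H : WDigraph V} {u v : V} (h : H.dist u v ≠ ⊤) : u ∈ H.verts :=
  (walk_dist h).mem_left

theorem mem_right_of_dist_ne_top {H : WDigraph V} {u v : V} (h : H.dist u v ≠ ⊤) : v ∈ H.verts :=
  (walk_dist h).mem_right

theorem dist_triangle (H : WDigraph V) (u v w : V) : H.dist u w ≤ H.dist u v + H.dist v w := by
  by_cases h : H.dist u v = ⊤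
  · simp [h]
  by_cases h' : H.dist v w = ⊤
  · simp [h']
  exact dist_le_of_walk ((walk_dist h).trans (walk_dist h'))

theorem dist_le_weight {H : WDigraph V} {u v : V} (hu : u ∈ H.verts) (hv : v ∈ H.verts) :
    H.dist u v ≤ H.w u v := by
  by_cases h : H.w u v = ⊤
  · simp [h]
  simpa using dist_le_of_walk ((Walk.nil hu).snoc ⟨hu, hv, h⟩)

theorem dist_le_dist_add_weight {H : WDigraph V} {u v w : V} (h : H.Adj v w) :
    H.dist u w ≤ H.dist u v + H.w v w :=
  (H.dist_triangle u v w).trans (by gcongr; exact dist_le_weight h.1 h.2.1)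

/-- A potential `φ` that does not increase along an edge by more than its weight does not increase
between two vertices by more than their distance. -/
theorem le_add_dist_of_potential {H : WDigraph V} (φ : V → ℝ≥0∞)
    (hφ : ∀ y y', H.Adj y y' → φ y' ≤ φ y + H.w y y') (u v : V) : φ v ≤ φ u + H.dist u v := by
  by_cases h : H.dist u v = ⊤
  · simp [h]
  have key : ∀ {v ℓ}, H.Walk u v ℓ → φ v ≤ φ u + ℓ := by
    intro v ℓ hw
    induction hw with
    | nil => simp
    | snoc _ ha ih =>
      rw [← add_assoc]
      exact (hφ _ _ ha).trans (by gcongr)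
  exact key (walk_dist h)

theorem le_mul_dist {H : WDigraph V} {u v : V} {a C : ℝ≥0∞} (hC : C ≠ 0)
    (h : ∀ ℓ, H.Walk u v ℓ → a ≤ C * ℓ) : a ≤ C * H.dist u v := by
  by_cases ht : H.dist u v = ⊤
  · simp [ht, ENNReal.mul_top hC]
  · exact h _ (walk_dist ht)

/-- Distances are at most those of a graph with fewer vertices and larger weights. -/
theorem dist_le_of_subgraph {H K : WDigraph V} (hv : K.verts ⊆ H.verts)
    (hw : ∀ y y', K.Adj y y' → H.w y y' ≤ K.w y y') (u v : V) : H.dist u v ≤ K.dist u v := by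
  by_cases h : K.dist u v = ⊤
  · simp [h]
  have := le_add_dist_of_potential (H := K) (fun y => H.dist u y) (fun y y' ha =>
    (dist_le_dist_add_weight (H := H) ⟨hv ha.1, hv ha.2.1,
      ne_top_of_le_ne_top ha.2.2 (hw y y' ha)⟩).trans (by gcongr; exact hw y y' ha)) u v
  rwa [dist_self (hv (mem_left_of_dist_ne_top h)), zero_add] at this

theorem Adj.of_del [DecidableEq V] {H : WDigraph V} {x u v : V} (h : (H.del x).Adj u v) :
    H.Adj u v ∧ u ≠ x ∧ v ≠ x :=
  ⟨⟨Finset.mem_of_mem_erase h.1, Finset.mem_of_mem_erase h.2.1, h.2.2⟩,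
    Finset.ne_of_mem_erase h.1, Finset.ne_of_mem_erase h.2.1⟩

theorem Adj.del [DecidableEq V] {H : WDigraph V} {x u v : V} (h : H.Adj u v) (hu : u ≠ x)
    (hv : v ≠ x) : (H.del x).Adj u v :=
  ⟨Finset.mem_erase.2 ⟨hu, h.1⟩, Finset.mem_erase.2 ⟨hv, h.2.1⟩, h.2.2⟩

theorem dist_le_dist_del [DecidableEq V] (H : WDigraph V) (x u v : V) :
    H.dist u v ≤ (H.del x).dist u v :=
  dist_le_of_subgraph (K := H.del x) (Finset.erase_subset _ _) (fun _ _ _ => le_rfl) u v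

end WDigraph

/-! ### Existence of shortest path trees -/

namespace RootedTree

variable {V : Type u}

/-- Each reachable vertex gets as parent its predecessor on a shortest path with as few edges as
possible; the number of these edges decreases from a vertex to its parent, so that edges of weight
zero do no harm. -/
theorem exists_isShortestPathTree [DecidableEq V] (G : WDigraph V) {s : V} (hs : s ∈ G.verts) :
    ∃ T : RootedTree V, T.IsShortestPathTree G s := by
  let Q : V → ℕ → Prop := fun v n => ∃ A, G.IsPath s v A ∧ G.len A = G.dist s v ∧ A.length = n
  let h : V → ℕ := fun v => sInf {n | Q v n}
  have hQ : ∀ v, G.dist s v ≠ ⊤ → Q v (h v) := fun v hv => by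
    obtain ⟨A, hA, he⟩ := WDigraph.exists_isPath_len_eq_dist hv
    exact Nat.sInf_mem (s := {n | Q v n}) ⟨_, A, hA, he, rfl⟩
  have hpar : ∀ v, ∃ y, G.dist s v ≠ ⊤ → v ≠ s →
      G.dist s y ≠ ⊤ ∧ h y < h v ∧ G.Adj y v ∧ G.dist s y + G.w y v = G.dist s v := by
    intro v
    by_cases hv : G.dist s v ≠ ⊤ ∧ v ≠ s
    swap
    · exact ⟨s, fun h1 h2 => absurd ⟨h1, h2⟩ hv⟩
    obtain ⟨A, hA, he, hn⟩ := hQ v hv.1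
    rcases hA.eq_or_exists_append with ⟨h1, -⟩ | ⟨B, y, rfl, hB, ha, hl⟩
    · exact absurd h1.symm hv.2
    have hle : G.dist s y ≤ G.len B := WDigraph.dist_le_of_walk (hB.walk _ rfl)
    have hge : G.len B ≤ G.dist s y := by
      have := WDigraph.dist_le_dist_add_weight (u := s) ha
      rw [← he, hl] at this
      exact (ENNReal.add_le_add_iff_right ha.2.2).1 this
    have heq := le_antisymm hle hge
    refine ⟨y, fun _ _ => ⟨?_, ?_, ha, ?_⟩⟩
    · rw [heq]
      exact (hB.walk _ rfl).ne_top
    · rw [← hn]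
      have : h y ≤ B.length := Nat.sInf_le ⟨B, hB, heq.symm, rfl⟩
      simpa using Nat.lt_succ_of_le this
    · rw [heq, ← hl, he]
  choose p hp using hpar
  let par : V → V := fun v => if v = s ∨ G.dist s v = ⊤ then s else p v
  have hss : G.dist s s ≠ ⊤ := by simp [WDigraph.dist_self hs]
  have hparv : ∀ v, G.dist s v ≠ ⊤ → v ≠ s → par v = p v := fun v h1 h2 => by simp [par, h1, h2]
  have hparm : ∀ v, G.dist s v ≠ ⊤ → G.dist s (par v) ≠ ⊤ := fun v h1 => by
    by_cases h2 : v = s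
    · simpa [par, h2] using hss
    · rw [hparv v h1 h2]; exact (hp v h1 h2).1
  have hmem : ∀ v, v ∈ G.verts.filter (fun v => G.dist s v ≠ ⊤) ↔ G.dist s v ≠ ⊤ := fun v =>
    ⟨fun h => (Finset.mem_filter.1 h).2,
      fun h => Finset.mem_filter.2 ⟨WDigraph.mem_right_of_dist_ne_top h, h⟩⟩
  let T : RootedTree V :=
    { verts := G.verts.filter fun v => G.dist s v ≠ ⊤
      root := s
      parent := par
      root_mem := (hmem s).2 hss
      parent_mem := fun v hv => (hmem _).2 (hparm v ((hmem v).1 hv))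
      parent_root := by simp [par]
      reaches_root := by
        intro v hv
        rw [hmem] at hv
        induction hn : h v using Nat.strong_induction_on generalizing v with
        | _ n ih =>
          by_cases h2 : v = s
          · exact ⟨0, h2⟩
          · obtain ⟨k, hk⟩ := ih (h (par v))
              (by rw [hparv v hv h2, ← hn]; exact (hp v hv h2).2.1) (par v) (hparm v hv) rfl
            exact ⟨k + 1, hk⟩ }
  refine ⟨T, rfl, fun v => Finset.mem_filter, fun v hv h2 => ?_, fun v hv => ?_⟩
  · have hv' := (hmem v).1 hv
    change G.Adj (par v) v
    rw [hparv v hv' h2]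
    exact (hp v hv' h2).2.2.1
  · apply le_antisymm
    · rw [hmem] at hv
      induction hn : h v using Nat.strong_induction_on generalizing v with
      | _ n ih =>
        by_cases h2 : v = s
        · subst h2
          exact (WDigraph.dist_self (H := T.toDigraph G) T.root_mem).le.trans zero_le
        · obtain ⟨h3, h4, h5, h6⟩ := hp v hv h2
          have := ih (h (p v)) (hn ▸ h4) (p v) h3 rfl
          have hw : (T.toDigraph G).w (p v) v = G.w (p v) v :=
            if_pos ⟨h2, hparv v hv h2⟩
          calc T.dist G s v ≤ (T.toDigraph G).dist s (p v) + (T.toDigraph G).w (p v) v :=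
                WDigraph.dist_le_dist_add_weight
                  ⟨(hmem _).2 h3, (hmem v).2 hv, by rw [hw]; exact h5.2.2⟩
            _ ≤ G.dist s (p v) + G.w (p v) v := by rw [hw]; gcongr; exact this
            _ = G.dist s v := h6
    · refine WDigraph.dist_le_of_subgraph (Finset.filter_subset _ _) (fun y y' ha => ?_) s v
      have := ha.2.2
      simp only [toDigraph] at this ⊢
      split_ifs with h
      · exact le_rfl
      · exact le_top

end RootedTree

end

section

/-! ### Ancestors and depths -/

namespace RootedTree

variable {V : Type u} {T : RootedTree V}

theorem iterate_mem {v : V} (hv : v ∈ T.verts) (k : ℕ) : T.parent^[k] v ∈ T.verts := by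
  induction k with
  | zero => exact hv
  | succ k ih => rw [Function.iterate_succ_apply']; exact T.parent_mem _ ih

theorem iterate_depth {v : V} (hv : v ∈ T.verts) : T.parent^[T.depth v] v = T.root :=
  Nat.sInf_mem (s := {k | T.parent^[k] v = T.root}) (T.reaches_root v hv)

theorem depth_root : T.depth T.root = 0 :=
  Nat.le_zero.1 (Nat.sInf_le (s := {k | T.parent^[k] T.root = T.root}) rfl)

theorem depth_eq {v : V} (hv : v ∈ T.verts) (h : v ≠ T.root) :
    T.depth v = T.depth (T.parent v) + 1 := by
  have h1 := iterate_depth hv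
  have h2 := iterate_depth (T.parent_mem v hv)
  apply le_antisymm
  · exact Nat.sInf_le (s := {k | T.parent^[k] v = T.root}) h2
  · cases hd : T.depth v with
    | zero => rw [hd] at h1; exact absurd h1 h
    | succ n =>
      rw [hd] at h1
      exact Nat.succ_le_succ (Nat.sInf_le (s := {k | T.parent^[k] (T.parent v) = T.root}) h1)

theorem depth_iterate {v : V} (hv : v ∈ T.verts) {k : ℕ} (hk : k ≤ T.depth v) :
    T.depth (T.parent^[k] v) + k = T.depth v := by
  induction k with
  | zero => rfl
  | succ k ih =>
    have h1 := ih (by omega)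
    have h2 : T.parent^[k] v ≠ T.root := fun h => by
      rw [h, depth_root] at h1
      omega
    have h3 := depth_eq (iterate_mem hv k) h2
    rw [Function.iterate_succ_apply']
    omega

theorem IsAncestor.refl {v : V} (hv : v ∈ T.verts) : T.IsAncestor v v := ⟨hv, 0, rfl⟩

theorem IsAncestor.mem_left {x t : V} (h : T.IsAncestor x t) : x ∈ T.verts := by
  obtain ⟨ht, k, rfl⟩ := h
  exact iterate_mem ht k

theorem IsAncestor.trans {x y t : V} (h : T.IsAncestor x y) (h' : T.IsAncestor y t) :
    T.IsAncestor x t := by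
  obtain ⟨_, k, rfl⟩ := h
  obtain ⟨ht, m, rfl⟩ := h'
  exact ⟨ht, k + m, Function.iterate_add_apply _ _ _ _⟩

theorem isAncestor_parent {v : V} (hv : v ∈ T.verts) : T.IsAncestor (T.parent v) v := ⟨hv, 1, rfl⟩

theorem isAncestor_root {v : V} (hv : v ∈ T.verts) : T.IsAncestor T.root v :=
  ⟨hv, _, iterate_depth hv⟩

theorem IsAncestor.depth_le_and_iterate {x t : V} (h : T.IsAncestor x t) :
    T.depth x ≤ T.depth t ∧ T.parent^[T.depth t - T.depth x] t = x := by
  obtain ⟨ht, k, hk⟩ := h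
  rcases le_total k (T.depth t) with h1 | h1
  · have h2 := depth_iterate ht h1
    rw [hk] at h2
    refine ⟨by omega, ?_⟩
    rw [← hk]
    congr 1
    rw [hk]
    omega
  · have h3 : ∀ m, T.parent^[m] T.root = T.root := fun m => by
      induction m with
      | zero => rfl
      | succ m ih => rw [Function.iterate_succ_apply, T.parent_root, ih]
    have hx : x = T.root := by
      obtain ⟨m, rfl⟩ := Nat.exists_eq_add_of_le' h1
      rw [← hk, Function.iterate_add_apply, iterate_depth ht, h3]
    subst hx
    rw [depth_root]
    exact ⟨Nat.zero_le _, iterate_depth ht⟩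

theorem IsAncestor.depth_le {x t : V} (h : T.IsAncestor x t) : T.depth x ≤ T.depth t :=
  h.depth_le_and_iterate.1

theorem IsAncestor.eq_of_depth_le {x t : V} (h : T.IsAncestor x t) (hd : T.depth t ≤ T.depth x) :
    x = t := by
  have h1 := h.depth_le_and_iterate.2
  rw [Nat.sub_eq_zero_of_le hd] at h1
  exact h1.symm

theorem IsAncestor.depth_lt {x t : V} (h : T.IsAncestor x t) (hne : x ≠ t) :
    T.depth x < T.depth t :=
  lt_of_not_ge fun hd => hne (h.eq_of_depth_le hd)

/-- The ancestors of a vertex form a chain. -/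
theorem IsAncestor.of_depth_le {x y t : V} (hx : T.IsAncestor x t) (hy : T.IsAncestor y t)
    (h : T.depth x ≤ T.depth y) : T.IsAncestor x y := by
  refine ⟨hy.mem_left, T.depth y - T.depth x, ?_⟩
  have h1 := hx.depth_le_and_iterate
  have h2 := hy.depth_le_and_iterate
  have e : T.depth t - T.depth x = (T.depth y - T.depth x) + (T.depth t - T.depth y) := by omega
  have h3 := h1.2
  rwa [e, Function.iterate_add_apply, h2.2] at h3

theorem IsAncestor.parent {x t : V} (h : T.IsAncestor x t) (hne : x ≠ t) :
    t ≠ T.root ∧ T.IsAncestor x (T.parent t) := by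
  have h1 := h.depth_lt hne
  have h2 : t ≠ T.root := fun h2 => by
    rw [h2, depth_root] at h1
    omega
  have h3 := depth_eq h.1 h2
  exact ⟨h2, h.of_depth_le (isAncestor_parent h.1) (by omega)⟩

theorem ne_of_isAncestor_parent {x v : V} (hv : v ∈ T.verts) (h : v ≠ T.root)
    (ha : T.IsAncestor x (T.parent v)) : v ≠ x := by
  rintro rfl
  have h1 := depth_eq hv h
  have h2 := ha.depth_le
  omega

/-- Induction along the tree path downwards from the vertex `x`. -/
theorem IsAncestor.induction {x : V} {Q : V → Prop} (base : Q x)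
    (step : ∀ v ∈ T.verts, v ≠ T.root → T.IsAncestor x (T.parent v) → Q (T.parent v) → Q v)
    {t : V} (h : T.IsAncestor x t) : Q t := by
  induction hn : T.depth t generalizing t with
  | zero =>
    by_cases hne : x = t
    · exact hne ▸ base
    · have := h.depth_lt hne
      omega
  | succ n ih =>
    by_cases hne : x = t
    · exact hne ▸ base
    · obtain ⟨h1, h2⟩ := h.parent hne
      have h3 := depth_eq h.1 h1
      exact step t h.1 h1 h2 (ih h2 (by omega))

/-! ### The path from the root to a vertex -/

theorem length_rootPath (z : V) : (T.rootPath z).length = T.depth z + 1 := by simp [rootPath]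

theorem rootPath_getElem? {z : V} (hz : z ∈ T.verts) (k : ℕ) (v : V) :
    (T.rootPath z)[k]? = some v ↔ T.IsAncestor v z ∧ T.depth v = k := by
  by_cases hk : k < T.depth z + 1
  · have h1 : (T.rootPath z)[k]? = some (T.parent^[T.depth z - k] z) := by
      simp [rootPath, hk]
    rw [h1, Option.some_inj]
    constructor
    · rintro rfl
      have := depth_iterate hz (Nat.sub_le (T.depth z) k)
      exact ⟨⟨hz, _, rfl⟩, by omega⟩
    · rintro ⟨ha, rfl⟩
      exact ha.depth_le_and_iterate.2
  · have h1 : (T.rootPath z)[k]? = none := by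
      rw [List.getElem?_eq_none_iff, length_rootPath]
      omega
    rw [h1]
    constructor
    · simp
    · rintro ⟨ha, rfl⟩
      have := ha.depth_le
      omega

theorem mem_rootPath {z : V} (hz : z ∈ T.verts) {v : V} :
    v ∈ T.rootPath z ↔ T.IsAncestor v z := by
  rw [List.mem_iff_getElem?]
  simp only [rootPath_getElem? hz]
  simp

theorem idxOf_rootPath [DecidableEq V] {z : V} (hz : z ∈ T.verts) {v : V}
    (hv : v ∈ T.rootPath z) : (T.rootPath z).idxOf v = T.depth v := by
  have h1 : (T.rootPath z)[(T.rootPath z).idxOf v]? = some v := by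
    simp [List.getElem?_eq_getElem (List.idxOf_lt_length_of_mem hv)]
  exact ((rootPath_getElem? hz _ _).1 h1).2.symm

/-! ### Shortest path trees -/

namespace IsShortestPathTree

variable [DecidableEq V] {G : WDigraph V} {s : V}

theorem dist_ne_top (hT : T.IsShortestPathTree G s) {v : V} (hv : v ∈ T.verts) :
    G.dist s v ≠ ⊤ := ((hT.mem_verts v).1 hv).2

theorem subset_verts (hT : T.IsShortestPathTree G s) : T.verts ⊆ G.verts := fun v hv =>
  ((hT.mem_verts v).1 hv).1

theorem mem_verts_of_dist (hT : T.IsShortestPathTree G s) {v : V} (h : G.dist s v ≠ ⊤) :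
    v ∈ T.verts := (hT.mem_verts v).2 ⟨WDigraph.mem_right_of_dist_ne_top h, h⟩

theorem adj_of_toDigraph_adj (hT : T.IsShortestPathTree G s) {y v : V}
    (h : (T.toDigraph G).Adj y v) : v ≠ s ∧ T.parent v = y ∧ (T.toDigraph G).w y v = G.w y v := by
  have h1 := h.2.2
  simp only [toDigraph, ne_eq, ite_eq_right_iff, not_forall] at h1
  obtain ⟨⟨h2, h3⟩, -⟩ := h1
  exact ⟨hT.root_eq ▸ h2, h3, if_pos ⟨h2, h3⟩⟩

theorem toDigraph_adj (hT : T.IsShortestPathTree G s) {v : V} (hv : v ∈ T.verts) (h : v ≠ s) :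
    (T.toDigraph G).Adj (T.parent v) v ∧
      (T.toDigraph G).w (T.parent v) v = G.w (T.parent v) v := by
  have hw : (T.toDigraph G).w (T.parent v) v = G.w (T.parent v) v :=
    if_pos ⟨hT.root_eq.symm ▸ h, rfl⟩
  exact ⟨⟨T.parent_mem v hv, hv, by rw [hw]; exact (hT.adj v hv h).2.2⟩, hw⟩

theorem dist_parent (hT : T.IsShortestPathTree G s) {v : V} (hv : v ∈ T.verts) (h : v ≠ s) :
    G.dist s (T.parent v) + G.w (T.parent v) v = G.dist s v := by
  apply le_antisymm _ (WDigraph.dist_le_dist_add_weight (hT.adj v hv h))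
  have h0 := hT.dist_eq v hv
  have h1 : (T.toDigraph G).dist s v ≠ ⊤ := by
    change T.dist G s v ≠ ⊤
    rw [h0]
    exact hT.dist_ne_top hv
  have h2 := WDigraph.walk_dist h1
  rw [← h0]
  change _ ≤ (T.toDigraph G).dist s v
  generalize hℓ : (T.toDigraph G).dist s v = ℓ at h2
  cases h2 with
  | nil => exact absurd rfl h
  | @snoc y _ ℓ hw ha =>
    obtain ⟨-, rfl, h4⟩ := hT.adj_of_toDigraph_adj ha
    rw [h4, ← hT.dist_eq _ (T.parent_mem v hv)]
    gcongr
    exact WDigraph.dist_le_of_walk hw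

/-- Any graph `K` that contains the tree path from `a` to `v` bounds the distance from `a` to `v` by
the length of this path. -/
theorem dist_add_dist_le (hT : T.IsShortestPathTree G s) {a v : V} (h : T.IsAncestor a v)
    (K : WDigraph V) (ha : a ∈ K.verts)
    (hK : ∀ y ∈ T.verts, y ≠ s → T.IsAncestor a (T.parent y) → T.IsAncestor y v →
      y ∈ K.verts ∧ K.w (T.parent y) y ≤ G.w (T.parent y) y) :
    G.dist s a + K.dist a v ≤ G.dist s v := by
  have hv := h.1
  suffices H : (∀ y ∈ T.verts, y ≠ s → T.IsAncestor a (T.parent y) → T.IsAncestor y v →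
      y ∈ K.verts ∧ K.w (T.parent y) y ≤ G.w (T.parent y) y) →
      v ∈ K.verts ∧ G.dist s a + K.dist a v ≤ G.dist s v from (H hK).2
  clear hK
  refine IsAncestor.induction (Q := fun v => (∀ y ∈ T.verts, y ≠ s →
      T.IsAncestor a (T.parent y) → T.IsAncestor y v →
      y ∈ K.verts ∧ K.w (T.parent y) y ≤ G.w (T.parent y) y) →
      v ∈ K.verts ∧ G.dist s a + K.dist a v ≤ G.dist s v) ?_ ?_ h
  · intro _
    simp [WDigraph.dist_self ha, ha]
  · intro v hv hr hav ih hK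
    obtain ⟨ih1, ih2⟩ := ih fun y h1 h2 h3 h4 => hK y h1 h2 h3 (h4.trans (isAncestor_parent hv))
    have hs : v ≠ s := hT.root_eq ▸ hr
    obtain ⟨k1, k2⟩ := hK v hv hs hav (IsAncestor.refl hv)
    have hadj := hT.adj v hv hs
    refine ⟨k1, ?_⟩
    calc G.dist s a + K.dist a v
        ≤ G.dist s a + (K.dist a (T.parent v) + K.w (T.parent v) v) := by
          gcongr
          exact WDigraph.dist_le_dist_add_weight ⟨ih1, k1, ne_top_of_le_ne_top hadj.2.2 k2⟩
      _ ≤ G.dist s (T.parent v) + G.w (T.parent v) v := by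
          rw [← add_assoc]
          gcongr
      _ = G.dist s v := hT.dist_parent hv hs

theorem dist_add_treeDist (hT : T.IsShortestPathTree G s) {a v : V} (h : T.IsAncestor a v) :
    G.dist s a + T.dist G a v = G.dist s v := by
  apply le_antisymm
  · refine hT.dist_add_dist_le h _ h.mem_left fun y hy hne _ _ => ⟨hy, ?_⟩
    exact (hT.toDigraph_adj hy hne).2.le
  · refine (G.dist_triangle s a v).trans ?_
    gcongr
    refine WDigraph.dist_le_of_subgraph hT.subset_verts (fun y y' ha => ?_) a v
    exact (hT.adj_of_toDigraph_adj ha).2.2.ge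

/-- The tree path from `a` to `v` survives the failure of a vertex `x` that is not on it. -/
theorem dist_add_dist_del_le (hT : T.IsShortestPathTree G s) {a v x : V}
    (h : T.IsAncestor a v) (hx : ¬ (T.IsAncestor a x ∧ T.IsAncestor x v)) :
    G.dist s a + (G.del x).dist a v ≤ G.dist s v := by
  refine hT.dist_add_dist_le h _ (Finset.mem_erase.2 ⟨?_, hT.subset_verts h.mem_left⟩)
    fun y hy hne h1 h2 => ⟨Finset.mem_erase.2 ⟨?_, hT.subset_verts hy⟩, le_rfl⟩
  · rintro rfl
    exact hx ⟨IsAncestor.refl h.mem_left, h⟩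
  · rintro rfl
    exact hx ⟨h1.trans (isAncestor_parent hy), h2⟩

theorem dist_del_eq (hT : T.IsShortestPathTree G s) {v x : V}
    (hx : ¬ T.IsAncestor x v) : (G.del x).dist s v = G.dist s v := by
  apply le_antisymm _ (G.dist_le_dist_del x s v)
  by_cases hv : v ∈ T.verts
  · have := hT.dist_add_dist_del_le (hT.root_eq ▸ isAncestor_root hv) (fun h => hx h.2)
    exact le_add_self.trans this
  · have : G.dist s v = ⊤ := by_contra fun h => hv (hT.mem_verts_of_dist h)
    rw [this]
    exact le_top

theorem treeDist_eq (hT : T.IsShortestPathTree G s) (v : V) : T.dist G s v = G.dist s v := by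
  by_cases hv : v ∈ T.verts
  · exact hT.dist_eq v hv
  · have h1 : G.dist s v = ⊤ := by_contra fun h => hv (hT.mem_verts_of_dist h)
    have h2 : T.dist G s v = ⊤ := by_contra fun h => hv (WDigraph.mem_right_of_dist_ne_top h)
    rw [h1, h2]

end IsShortestPathTree

/-! ### Centroid bipartitions -/

namespace IsCentroidBipartition

variable [DecidableEq V] {z : V} {A B : Finset V}

theorem subset_left (h : T.IsCentroidBipartition z A B) : A ⊆ T.verts :=
  h.union ▸ Finset.subset_union_left

theorem subset_right (h : T.IsCentroidBipartition z A B) : B ⊆ T.verts :=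
  h.union ▸ Finset.subset_union_right

theorem mem_left (h : T.IsCentroidBipartition z A B) : z ∈ A :=
  (Finset.mem_inter.1 (h.inter ▸ Finset.mem_singleton_self z)).1

theorem mem_right (h : T.IsCentroidBipartition z A B) : z ∈ B :=
  (Finset.mem_inter.1 (h.inter ▸ Finset.mem_singleton_self z)).2

theorem eq_of_mem (h : T.IsCentroidBipartition z A B) {v : V} (hA : v ∈ A) (hB : v ∈ B) : v = z :=
  Finset.mem_singleton.1 (h.inter ▸ Finset.mem_inter.2 ⟨hA, hB⟩)

theorem mem_or_mem (h : T.IsCentroidBipartition z A B) {v : V} (hv : v ∈ T.verts) :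
    v ∈ A ∨ v ∈ B := Finset.mem_union.1 (h.union.symm ▸ hv)

theorem parent_mem_right (h : T.IsCentroidBipartition z A B) {v : V} (hv : v ∈ B) (hne : v ≠ z) :
    v ≠ T.root ∧ T.parent v ∈ B := by
  have hr : v ≠ T.root := fun hr => hne (h.eq_of_mem (hr ▸ h.root_mem) hv)
  rcases h.edges v (h.subset_right hv) hr with ⟨_, h2⟩ | ⟨h1, _⟩
  · exact absurd (h.eq_of_mem h2 hv) hne
  · exact ⟨hr, h1⟩

theorem isAncestor_right (h : T.IsCentroidBipartition z A B) {v : V} (hv : v ∈ B) :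
    T.IsAncestor z v := by
  induction hn : T.depth v using Nat.strong_induction_on generalizing v with
  | _ n ih =>
    by_cases hne : v = z
    · exact hne ▸ IsAncestor.refl (h.subset_right hv)
    · obtain ⟨h1, h2⟩ := h.parent_mem_right hv hne
      have h3 := depth_eq (h.subset_right hv) h1
      exact (ih _ (by omega) h2 rfl).trans (isAncestor_parent (h.subset_right hv))

theorem parent_mem_left (h : T.IsCentroidBipartition z A B) {v : V} (hv : v ∈ A) :
    T.parent v ∈ A := by
  by_cases hr : v = T.root
  · rw [hr, T.parent_root]
    exact h.root_mem
  have hvT := h.subset_left hv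
  rcases h.edges v hvT hr with h1 | ⟨h1, h2⟩
  · exact h1.1
  · -- then `v = z`, and `z` would be an ancestor of its own parent
    have h3 := h.eq_of_mem hv h2
    exact absurd h3 (ne_of_isAncestor_parent hvT hr (h.isAncestor_right h1))

theorem mem_left_of_isAncestor (h : T.IsCentroidBipartition z A B) {a v : V} (hv : v ∈ A)
    (ha : T.IsAncestor a v) : a ∈ A := by
  obtain ⟨_, k, rfl⟩ := ha
  clear * - h hv
  induction k with
  | zero => exact hv
  | succ k ih => rw [Function.iterate_succ_apply']; exact h.parent_mem_left ih

theorem mem_right_of_isAncestor (h : T.IsCentroidBipartition z A B) {a v : V}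
    (hz : T.IsAncestor z a) (ha : T.IsAncestor a v) (hv : v ∈ B) : a ∈ B := by
  induction hn : T.depth v using Nat.strong_induction_on generalizing v with
  | _ n ih =>
    by_cases hav : a = v
    · exact hav ▸ hv
    have h0 := ha.depth_lt hav
    have h5 := hz.depth_le
    obtain ⟨h1, h2⟩ := h.parent_mem_right hv (fun e => by rw [e] at h0; omega)
    have h3 := depth_eq ha.1 h1
    exact ih _ (by omega) (ha.parent hav).2 h2 rfl

end IsCentroidBipartition

/-! ### Existence of centroid bipartitions -/

section Existence

variable [DecidableEq V]

theorem forest_adj {z u v : V} : (T.forest z).Adj u v ↔ u ≠ v ∧ u ∈ T.verts.erase z ∧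
    v ∈ T.verts.erase z ∧ ((v ≠ T.root ∧ T.parent v = u) ∨ (u ≠ T.root ∧ T.parent u = v)) := by
  rw [forest, SimpleGraph.fromRel_adj]
  tauto

/-- A set of vertices that is closed under adjacency contains the component of each of its
vertices. -/
theorem mem_of_forest_reachable {z u v : V} (Q : V → Prop)
    (hQ : ∀ a b, (T.forest z).Adj a b → Q a → Q b) (h : (T.forest z).Reachable u v) (hu : Q u) :
    Q v := by
  obtain ⟨p⟩ := h
  induction p with
  | nil => exact hu
  | cons ha _ ih => exact ih (hQ _ _ ha hu)

/-- A vertex with a minimal number of descendants among those that are ancestors of more than half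
of the vertices is a centroid. -/
theorem exists_isCentroid (T : RootedTree V) : ∃ z, T.IsCentroid z := by
  let D : V → Finset V := fun v => T.verts.filter (T.IsAncestor v)
  have hDroot : D T.root = T.verts := Finset.filter_true_of_mem fun v hv => isAncestor_root hv
  have hne : (T.verts.filter fun v => T.verts.card < 2 * (D v).card).Nonempty := by
    refine ⟨T.root, Finset.mem_filter.2 ⟨T.root_mem, ?_⟩⟩
    rw [hDroot]
    have := Finset.card_pos.2 ⟨_, T.root_mem⟩
    omega
  obtain ⟨z, hz, hmin⟩ := Finset.exists_min_image _ (fun v => (D v).card) hne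
  obtain ⟨hzT, hzD⟩ := Finset.mem_filter.1 hz
  refine ⟨z, hzT, fun v hv => ?_⟩
  obtain ⟨hvz, hvT⟩ := Finset.mem_erase.1 hv
  by_cases ha : T.IsAncestor z v
  · -- the component of `v` lies below a child `c` of `z`
    obtain ⟨c, hc1, hc2, hc3, hc4⟩ : ∃ c ∈ T.verts, c ≠ T.root ∧ T.parent c = z ∧
        T.IsAncestor c v := by
      refine (IsAncestor.induction (x := z) (Q := fun v => v ≠ z → ∃ c ∈ T.verts, c ≠ T.root ∧
        T.parent c = z ∧ T.IsAncestor c v) (fun h => absurd rfl h) ?_ ha) hvz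
      intro v hv hr h1 ih _
      by_cases hp : T.parent v = z
      · exact ⟨v, hv, hr, hp, IsAncestor.refl hv⟩
      · obtain ⟨c, h2, h3, h4, h5⟩ := ih hp
        exact ⟨c, h2, h3, h4, h5.trans (isAncestor_parent hv)⟩
    have hsub : ((T.verts.erase z).filter fun u => (T.forest z).Reachable v u) ⊆ D c := by
      intro u hu
      obtain ⟨hu1, hu2⟩ := Finset.mem_filter.1 hu
      refine Finset.mem_filter.2 ⟨Finset.mem_of_mem_erase hu1, ?_⟩
      refine mem_of_forest_reachable (T.IsAncestor c) ?_ hu2 hc4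
      intro a b hab hca
      obtain ⟨_, ha1, hb1, h | h⟩ := forest_adj.1 hab
      · exact hca.trans (h.2 ▸ isAncestor_parent (Finset.mem_of_mem_erase hb1))
      · by_cases hac : c = a
        · subst hac
          exact absurd (h.2.symm.trans hc3) (Finset.ne_of_mem_erase hb1)
        · exact h.2 ▸ (hca.parent hac).2
    have hlt : (D c).card < (D z).card := by
      apply Finset.card_lt_card
      refine ⟨fun u hu => ?_, fun hsub' => ?_⟩
      · obtain ⟨h1, h2⟩ := Finset.mem_filter.1 hu
        exact Finset.mem_filter.2 ⟨h1, (hc3 ▸ isAncestor_parent hc1 : T.IsAncestor z c).trans h2⟩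
      · have h1 := (Finset.mem_filter.1 (hsub' (Finset.mem_filter.2
          ⟨hzT, IsAncestor.refl hzT⟩))).2.depth_le
        have h2 := depth_eq hc1 hc2
        rw [hc3] at h2
        omega
    have hnot : ¬ T.verts.card < 2 * (D c).card := fun h => by
      have := hmin c (Finset.mem_filter.2 ⟨hc1, h⟩)
      omega
    have := Finset.card_le_card hsub
    omega
  · -- the component of `v` consists of non-descendants of `z`
    have hsub : ((T.verts.erase z).filter fun u => (T.forest z).Reachable v u) ⊆
        T.verts \ D z := by
      intro u hu
      obtain ⟨hu1, hu2⟩ := Finset.mem_filter.1 hu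
      refine Finset.mem_sdiff.2 ⟨Finset.mem_of_mem_erase hu1, fun hD => ?_⟩
      refine mem_of_forest_reachable (fun a => ¬ T.IsAncestor z a) ?_ hu2 ha
        (Finset.mem_filter.1 hD).2
      intro a b hab hza hzb
      obtain ⟨_, ha1, hb1, h | h⟩ := forest_adj.1 hab
      · exact hza (h.2 ▸ (hzb.parent (Finset.ne_of_mem_erase hb1).symm).2)
      · exact hza (hzb.trans (h.2 ▸ isAncestor_parent (Finset.mem_of_mem_erase ha1)))
    have h1 := Finset.card_le_card hsub
    have h2 := Finset.card_sdiff_add_card_eq_card (Finset.filter_subset (T.IsAncestor z) T.verts)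
    have h3 : (D z).card = (T.verts.filter (T.IsAncestor z)).card := rfl
    have h4 : (T.verts \ D z).card = (T.verts \ T.verts.filter (T.IsAncestor z)).card := rfl
    omega

/-- Some union of components of `T - z`, for a centroid `z`, contains between one and two thirds of
the vertices: consider one that has as many vertices as possible, but at most two thirds. -/
theorem exists_balanced_union {z : V} (hz : T.IsCentroid z) (hcard : 6 < T.verts.card) :
    ∃ X ⊆ T.verts.erase z, (∀ a b, (T.forest z).Adj a b → a ∈ X → b ∈ X) ∧
      T.verts.card - 1 ≤ 3 * X.card ∧ 3 * X.card ≤ 2 * (T.verts.card - 1) := by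
  let S := (T.verts.erase z).powerset.filter fun X =>
    (∀ a b, (T.forest z).Adj a b → a ∈ X → b ∈ X) ∧ 3 * X.card ≤ 2 * (T.verts.card - 1)
  have hS : ∀ X, X ∈ S ↔ X ⊆ T.verts.erase z ∧ (∀ a b, (T.forest z).Adj a b → a ∈ X → b ∈ X) ∧
      3 * X.card ≤ 2 * (T.verts.card - 1) := fun X => by
    rw [Finset.mem_filter, Finset.mem_powerset]
  obtain ⟨X, hX, hmax⟩ := Finset.exists_max_image S Finset.card
    ⟨∅, (hS ∅).2 ⟨Finset.empty_subset _, by simp, by simp⟩⟩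
  obtain ⟨h1, h2, h3⟩ := (hS X).1 hX
  refine ⟨X, h1, h2, ?_, h3⟩
  by_contra hlt
  have hcz := Finset.card_erase_of_mem hz.1
  obtain ⟨v, hv, hvX⟩ : ∃ v ∈ T.verts.erase z, v ∉ X := by
    by_contra hc
    push Not at hc
    have := Finset.card_le_card (show T.verts.erase z ⊆ X from hc)
    omega
  let C := (T.verts.erase z).filter fun u => (T.forest z).Reachable v u
  have hC2 : 2 * C.card ≤ T.verts.card := hz.2 v hv
  have hvC : v ∈ C := Finset.mem_filter.2 ⟨hv, SimpleGraph.Reachable.refl v⟩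
  have hCcl : ∀ a b, (T.forest z).Adj a b → a ∈ C → b ∈ C := fun a b hab ha =>
    Finset.mem_filter.2 ⟨(forest_adj.1 hab).2.2.1, (Finset.mem_filter.1 ha).2.trans hab.reachable⟩
  have hCS := hmax C ((hS C).2 ⟨Finset.filter_subset _ _, hCcl, by omega⟩)
  have hdisj : Disjoint X C := by
    rw [Finset.disjoint_left]
    intro u hu huC
    exact hvX (mem_of_forest_reachable (· ∈ X) h2 (Finset.mem_filter.1 huC).2.symm hu)
  have hcard' := Finset.card_union_of_disjoint hdisj
  have hpos : 0 < C.card := Finset.card_pos.2 ⟨v, hvC⟩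
  have := hmax (X ∪ C) ((hS _).2 ⟨Finset.union_subset h1 (Finset.filter_subset _ _), fun a b hab h =>
    Finset.mem_union.2 ((Finset.mem_union.1 h).imp (h2 a b hab) (hCcl a b hab)), by omega⟩)
  omega

theorem exists_isCentroidBipartition (T : RootedTree V) (hcard : 6 < T.verts.card) :
    ∃ z A B, T.IsCentroidBipartition z A B := by
  obtain ⟨z, hz⟩ := exists_isCentroid T
  obtain ⟨X, hX, hcl, hlo, hhi⟩ := exists_balanced_union hz hcard
  -- one of `X` and its complement contains no root
  obtain ⟨Y, hY, hcl, hlo, hhi, hroot⟩ : ∃ Y ⊆ T.verts.erase z,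
      (∀ a b, (T.forest z).Adj a b → a ∈ Y → b ∈ Y) ∧
      T.verts.card - 1 ≤ 3 * Y.card ∧ 3 * Y.card ≤ 2 * (T.verts.card - 1) ∧ T.root ∉ Y := by
    by_cases hr : T.root ∈ X
    · have hc := Finset.card_sdiff_add_card_eq_card hX
      have hcz := Finset.card_erase_of_mem hz.1
      refine ⟨T.verts.erase z \ X, Finset.sdiff_subset, fun a b hab ha => ?_, by omega, by omega,
        fun h => (Finset.mem_sdiff.1 h).2 hr⟩
      exact Finset.mem_sdiff.2 ⟨(forest_adj.1 hab).2.2.1, fun hb =>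
        (Finset.mem_sdiff.1 ha).2 (hcl b a hab.symm hb)⟩
    · exact ⟨X, hX, hcl, hlo, hhi, hr⟩
  have hzY : z ∉ Y := fun h => Finset.ne_of_mem_erase (hY h) rfl
  have hYT : Y ⊆ T.verts := hY.trans (Finset.erase_subset _ _)
  have hB : (insert z Y).card = Y.card + 1 := Finset.card_insert_of_notMem hzY
  have hA := Finset.card_sdiff_add_card_eq_card hYT
  refine ⟨z, T.verts \ Y, insert z Y, hz, ?_, ?_, ?_, ?_, by omega, by omega, by omega, by omega⟩
  · ext v
    simp only [Finset.mem_union, Finset.mem_sdiff, Finset.mem_insert]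
    constructor
    · rintro (h | rfl | h)
      · exact h.1
      · exact hz.1
      · exact hYT h
    · intro h
      by_cases hv : v ∈ Y <;> simp [h, hv]
  · ext v
    simp only [Finset.mem_inter, Finset.mem_sdiff, Finset.mem_insert, Finset.mem_singleton]
    constructor
    · rintro ⟨h1, rfl | h2⟩
      · rfl
      · exact absurd h2 h1.2
    · rintro rfl
      exact ⟨⟨hz.1, hzY⟩, Or.inl rfl⟩
  · intro v hv hr
    have hp := T.parent_mem v hv
    simp only [Finset.mem_sdiff, Finset.mem_insert]
    have hne : T.parent v ≠ v := (ne_of_isAncestor_parent hv hr (IsAncestor.refl hp)).symm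
    by_cases h1 : v = z
    · subst h1
      by_cases h2 : T.parent v ∈ Y
      · exact Or.inr ⟨Or.inr h2, Or.inl rfl⟩
      · exact Or.inl ⟨⟨hp, h2⟩, hv, hzY⟩
    by_cases h2 : T.parent v = z
    · by_cases h3 : v ∈ Y
      · exact Or.inr ⟨Or.inl h2, Or.inr h3⟩
      · exact Or.inl ⟨⟨hp, h2 ▸ hzY⟩, hv, h3⟩
    have hadj : (T.forest z).Adj (T.parent v) v := forest_adj.2
      ⟨hne, Finset.mem_erase.2 ⟨h2, hp⟩, Finset.mem_erase.2 ⟨h1, hv⟩, Or.inl ⟨hr, rfl⟩⟩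
    by_cases h3 : v ∈ Y
    · exact Or.inr ⟨Or.inr (hcl _ _ hadj.symm h3), Or.inr h3⟩
    · exact Or.inl ⟨⟨hp, fun h => h3 (hcl _ _ hadj h)⟩, hv, h3⟩
  · exact Finset.mem_sdiff.2 ⟨T.root_mem, hroot⟩

end Existence

end RootedTree

end

section

variable {V : Type u} [DecidableEq V]

/-! ### One phase of the progressive Dijkstra algorithm -/

/-- The invariant of the while loop of phase `j`, which starts in the state `S₀`; `X` is the set of
the vertices extracted from the heap so far. No vertex is extracted twice. The vertices of `X` and of
the heap are the active ones. An edge leaving `X` is relaxed exactly if its head is active, and up to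
the factor `1 + ε₂` otherwise. The predicate `R v b d` stands for any property of the pairs
`(b[v], d[v])` of the active vertices that is passed on along the edges. -/
structure PhaseInv (H : WDigraph (Option V)) (ε₂ : ℝ) (j : ℕ) (R : V → Option V → ℝ≥0∞ → Prop)
    (S₀ S : PDState V) (X : Finset (Option V)) : Prop where
  extracted_subset : X ⊆ H.verts
  heap_subset : S.heap ⊆ H.verts
  disjoint : ∀ v ∈ X, v ∉ S.heap
  source_mem : none ∈ X ∨ none ∈ S.heap
  of_source_mem_heap : none ∈ S.heap → X = ∅ ∧ S.heap = {none}
  d_source : S.d none = 0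
  mono : ∀ u ∈ X, ∀ v ∈ S.heap, S.d u ≤ S.d v
  inactive : ∀ v, v ∉ X → v ∉ S.heap →
    S.d v = S₀.d v ∧ S.b v = S₀.b v ∧ S.upd v j = S₀.upd v j
  upd_other : ∀ v, ∀ j' ≠ j, S.upd v j' = S₀.upd v j'
  upd_active : ∀ v, v ∈ X ∨ v ∈ S.heap → v ≠ none → S.upd v j = some (S.d v, S.b v)
  relaxed : ∀ u ∈ X, ∀ v, H.Adj u v → v ∈ X ∨ v ∈ S.heap → S.d v ≤ S.d u + H.w u v
  almost_relaxed : ∀ u ∈ X, ∀ v, H.Adj u v → v ∉ X → v ∉ S.heap →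
    S₀.d v ≤ ENNReal.ofReal (1 + ε₂) * (S.d u + H.w u v)
  sound : ∀ v, some v ∈ X ∨ some v ∈ S.heap → R v (S.b (some v)) (S.d (some v))

theorem one_le_ofReal {ε : ℝ} (hε : 0 ≤ ε) : 1 ≤ ENNReal.ofReal (1 + ε) := by
  rw [← ENNReal.ofReal_one]
  exact ENNReal.ofReal_le_ofReal (by linarith)

theorem div_ofReal_le {ε : ℝ} (hε : 0 ≤ ε) (a : ℝ≥0∞) : a / ENNReal.ofReal (1 + ε) ≤ a :=
  ENNReal.div_le_of_le_mul (le_mul_of_one_le_right' (one_le_ofReal hε))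

theorem le_ofReal_mul_iff {ε : ℝ} (hε : 0 ≤ ε) (a c : ℝ≥0∞) :
    a / ENNReal.ofReal (1 + ε) ≤ c ↔ a ≤ ENNReal.ofReal (1 + ε) * c := by
  have h1 := one_le_ofReal hε
  rw [mul_comm]
  exact ENNReal.div_le_iff (zero_lt_one.trans_le h1).ne' ENNReal.ofReal_ne_top

section Phase

variable {H : WDigraph (Option V)} {ε₂ : ℝ} {j : ℕ} {R : V → Option V → ℝ≥0∞ → Prop}
  {S₀ S S' : PDState V} {X : Finset (Option V)}

theorem PhaseInv.step (hε : 0 ≤ ε₂) (hnone : ∀ u, H.w u none = ⊤)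
    (hinit : ∀ v, H.Adj none (some v) → R v (S₀.b (some v)) (H.w none (some v)))
    (hstep : ∀ u v β ℓ, R u β ℓ → H.Adj (some u) (some v) → R v β (ℓ + H.w (some u) (some v)))
    (h : PhaseInv H ε₂ j R S₀ S X) (hS : PDStep H ε₂ j S S') :
    ∃ X', PhaseInv H ε₂ j R S₀ S' X' ∧ X'.card = X.card + 1 := by
  obtain ⟨u, hu, hmin, rfl⟩ := hS
  have huX : u ∉ X := fun hX => h.disjoint u hX hu
  let changed : Option V → Prop := fun v =>
    Decreases H { S with heap := S.heap.erase u } u v ∨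
      Activates H ε₂ { S with heap := S.heap.erase u } u v
  have hdd : ∀ {v}, v ∈ X ∨ v = u → S.d v ≤ S.d u := by
    rintro v (hv | rfl)
    · exact h.mono v hv u hu
    · exact le_rfl
  have hch_adj : ∀ {v}, changed v → H.Adj u v := fun hv => hv.elim (·.1) (·.1)
  have hch_lt : ∀ {v}, changed v → S.d u + H.w u v < S.d v := fun hv =>
    hv.elim (·.2.1) fun hv => hv.2.1.trans_le (div_ofReal_le hε _)
  have hch_X : ∀ {v}, changed v → v ∉ X ∧ v ≠ u := by
    intro v hv
    have h1 := hch_lt hv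
    rw [← not_or]
    intro h2
    exact absurd (h1.trans_le (hdd h2)) (not_lt.2 le_self_add)
  have hch_none : ∀ {v}, changed v → v ≠ none := by
    rintro v hv rfl
    exact (hch_adj hv).2.2 (hnone u)
  set S' := scan H ε₂ j u { S with heap := S.heap.erase u } with hS'
  have hheap : ∀ v, v ∈ S'.heap ↔ (v ≠ u ∧ v ∈ S.heap) ∨ changed v := by
    intro v
    change v ∈ S.heap.erase u ∪ H.verts.filter _ ↔ _
    rw [Finset.mem_union, Finset.mem_erase, Finset.mem_filter]
    constructor
    · rintro (h1 | h1)
      · exact Or.inl h1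
      · exact Or.inr (Or.inr h1.2)
    · rintro (h1 | h1 | h1)
      · exact Or.inl h1
      · exact Or.inl (Finset.mem_erase.1 h1.2.2)
      · exact Or.inr ⟨h1.1.2.1, h1⟩
  have hd1 : ∀ {v}, changed v → S'.d v = S.d u + H.w u v := fun hv => if_pos hv
  have hd2 : ∀ {v}, ¬ changed v → S'.d v = S.d v := fun hv => if_neg hv
  have hb2 : ∀ {v}, ¬ changed v → S'.b v = S.b v := fun hv => if_neg fun h => hv h.1
  have hupd1 : ∀ {v}, changed v →
      S'.upd v = Function.update (S.upd v) j (some (S'.d v, S'.b v)) := fun hv => by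
    rw [hd1 hv]; exact if_pos hv
  have hupd2 : ∀ {v}, ¬ changed v → S'.upd v = S.upd v := fun hv => if_neg hv
  have hdle : ∀ v, S'.d v ≤ S.d v := by
    intro v
    by_cases hv : changed v
    · rw [hd1 hv]; exact (hch_lt hv).le
    · rw [hd2 hv]
  have hdX : ∀ {v}, v ∈ insert u X → S'.d v = S.d v := fun {v} hv => hd2 fun hc => by
    rcases Finset.mem_insert.1 hv with rfl | hv
    · exact (hch_X hc).2 rfl
    · exact (hch_X hc).1 hv
  -- a vertex that is active now and was not active before has just been activated
  have hnew : ∀ {v}, v ∈ insert u X ∨ v ∈ S'.heap → v ∉ X → v ∉ S.heap →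
      changed v ∧ S.d u + H.w u v < S₀.d v / ENNReal.ofReal (1 + ε₂) := by
    intro v hv h1 h2
    have hvu : v ≠ u := fun e => h2 (e ▸ hu)
    have hc : changed v := by
      rcases hv with hv | hv
      · rcases Finset.mem_insert.1 hv with hv | hv
        · exact absurd hv hvu
        · exact absurd hv h1
      · rcases (hheap v).1 hv with hv | hv
        · exact absurd hv.2 h2
        · exact hv
    refine ⟨hc, ?_⟩
    rcases hc with hc | hc
    · exact absurd (Finset.mem_of_mem_erase hc.2.2) h2
    · have := hc.2.1
      rwa [(h.inactive v h1 h2).1] at this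
  have hold : ∀ {v}, v ∉ insert u X → v ∉ S'.heap → v ∉ X ∧ v ∉ S.heap ∧ ¬ changed v := by
    intro v h1 h2
    rw [Finset.mem_insert, not_or] at h1
    rw [hheap, not_or] at h2
    exact ⟨h1.2, fun h3 => h2.1 ⟨h1.1, h3⟩, h2.2⟩
  refine ⟨insert u X, ⟨?_, ?_, ?_, ?_, ?_, ?_, ?_, ?_, ?_, ?_, ?_, ?_, ?_⟩,
    Finset.card_insert_of_notMem huX⟩
  · exact Finset.insert_subset (h.heap_subset hu) h.extracted_subset
  · intro v hv
    rcases (hheap v).1 hv with hv | hv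
    · exact h.heap_subset hv.2
    · exact (hch_adj hv).2.1
  · intro v hv hv'
    rcases (hheap v).1 hv' with h1 | h1
    · rcases Finset.mem_insert.1 hv with h2 | h2
      · exact h1.1 h2
      · exact h.disjoint v h2 h1.2
    · rcases Finset.mem_insert.1 hv with h2 | h2
      · exact (hch_X h1).2 h2
      · exact (hch_X h1).1 h2
  · left
    rcases h.source_mem with h1 | h1
    · exact Finset.mem_insert_of_mem h1
    · rw [(h.of_source_mem_heap h1).2, Finset.mem_singleton] at hu
      exact hu ▸ Finset.mem_insert_self _ _
  · intro hn
    rcases (hheap none).1 hn with h1 | h1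
    · rw [(h.of_source_mem_heap h1.2).2, Finset.mem_singleton] at hu
      exact absurd hu.symm h1.1
    · exact absurd rfl (hch_none h1)
  · rw [hd2 fun hc => hch_none hc rfl]
    exact h.d_source
  · intro y hy v hv
    rw [hdX hy]
    have h1 := hdd ((Finset.mem_insert.1 hy).symm)
    by_cases hc : changed v
    · rw [hd1 hc]
      exact h1.trans le_self_add
    · rw [hd2 hc]
      rcases (hheap v).1 hv with h2 | h2
      · exact h1.trans (hmin v h2.2)
      · exact absurd h2 hc
  · intro v h1 h2
    obtain ⟨h3, h4, h5⟩ := hold h1 h2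
    rw [hd2 h5, hb2 h5, hupd2 h5]
    exact h.inactive v h3 h4
  · intro v j' hj
    by_cases hc : changed v
    · rw [hupd1 hc, Function.update_of_ne hj]
      exact h.upd_other v j' hj
    · rw [hupd2 hc]
      exact h.upd_other v j' hj
  · intro v hv hn
    by_cases hc : changed v
    · rw [hupd1 hc, Function.update_self]
    · rw [hupd2 hc, hd2 hc, hb2 hc]
      refine h.upd_active v ?_ hn
      by_contra h1
      rw [not_or] at h1
      exact hc (hnew hv h1.1 h1.2).1
  · intro y hy v ha hv
    rw [hdX hy]
    rcases Finset.mem_insert.1 hy with rfl | hy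
    · by_cases hc : changed v
      · exact (hd1 hc).le
      · rw [hd2 hc]
        by_cases h1 : v ∈ X ∨ v = y
        · exact (hdd h1).trans le_self_add
        · rw [not_or] at h1
          by_cases h2 : v ∈ S.heap
          · exact not_lt.1 fun h3 => hc (Or.inl ⟨ha, h3, Finset.mem_erase.2 ⟨h1.2, h2⟩⟩)
          · exact absurd (hnew hv h1.1 h2).1 hc
    · by_cases h1 : v ∈ X ∨ v ∈ S.heap
      · exact (hdle v).trans (h.relaxed y hy v ha h1)
      · rw [not_or] at h1
        obtain ⟨hc, hlt⟩ := hnew hv h1.1 h1.2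
        rw [hd1 hc]
        exact hlt.le.trans ((le_ofReal_mul_iff hε _ _).2 (h.almost_relaxed y hy v ha h1.1 h1.2))
  · intro y hy v ha h1 h2
    rw [hdX hy]
    obtain ⟨h3, h4, h5⟩ := hold h1 h2
    rcases Finset.mem_insert.1 hy with rfl | hy
    · rw [← le_ofReal_mul_iff hε, ← (h.inactive v h3 h4).1]
      exact not_lt.1 fun h6 => h5 (Or.inr ⟨ha, h6, fun h7 => h4 (Finset.mem_of_mem_erase h7)⟩)
    · exact h.almost_relaxed y hy v ha h3 h4
  · intro v hv
    by_cases hc : changed (some v)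
    · rw [hd1 hc]
      have hadj := hch_adj hc
      cases u with
      | none =>
        have hb : S'.b (some v) = S.b (some v) := if_neg fun h => h.2 rfl
        obtain ⟨h1, h2⟩ := h.of_source_mem_heap hu
        rw [hb, h.d_source, zero_add,
          (h.inactive (some v) (by rw [h1]; simp) (by rw [h2]; simp)).2.1]
        exact hinit v hadj
      | some u =>
        have hb : S'.b (some v) = S.b (some u) := if_pos ⟨hc, by simp⟩
        rw [hb]
        exact hstep u v _ _ (h.sound u (Or.inr hu)) hadj
    · rw [hd2 hc, hb2 hc]
      refine h.sound v ?_
      by_contra h1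
      rw [not_or] at h1
      exact hc (hnew hv h1.1 h1.2).1

theorem PhaseInv.of_reflTransGen (hε : 0 ≤ ε₂) (hnone : ∀ u, H.w u none = ⊤)
    (hinit : ∀ v, H.Adj none (some v) → R v (S₀.b (some v)) (H.w none (some v)))
    (hstep : ∀ u v β ℓ, R u β ℓ → H.Adj (some u) (some v) → R v β (ℓ + H.w (some u) (some v)))
    (h : PhaseInv H ε₂ j R S₀ S X) (hS : Relation.ReflTransGen (PDStep H ε₂ j) S S') :
    ∃ X', PhaseInv H ε₂ j R S₀ S' X' := by
  induction hS with
  | refl => exact ⟨X, h⟩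
  | tail _ hstep' ih =>
    obtain ⟨X', h'⟩ := ih
    obtain ⟨X'', h'', -⟩ := h'.step hε hnone hinit hstep hstep'
    exact ⟨X'', h''⟩

/-- The while loop terminates, because every iteration extracts a new vertex. -/
theorem PhaseInv.exists_reflTransGen (hε : 0 ≤ ε₂) (hnone : ∀ u, H.w u none = ⊤)
    (h : PhaseInv H ε₂ j (fun _ _ _ => True) S₀ S X) :
    ∃ S', Relation.ReflTransGen (PDStep H ε₂ j) S S' ∧ S'.heap = ∅ := by
  induction hn : H.verts.card - X.card generalizing S X with
  | zero =>
    refine ⟨S, Relation.ReflTransGen.refl, ?_⟩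
    have hX := Finset.eq_of_subset_of_card_le h.extracted_subset (by omega)
    exact Finset.eq_empty_of_forall_notMem fun v hv =>
      h.disjoint v (hX ▸ h.heap_subset hv) hv
  | succ n ih =>
    by_cases he : S.heap = ∅
    · exact ⟨S, Relation.ReflTransGen.refl, he⟩
    obtain ⟨u, hu, hmin⟩ := Finset.exists_min_image S.heap S.d (Finset.nonempty_iff_ne_empty.2 he)
    have hs : PDStep H ε₂ j S (scan H ε₂ j u { S with heap := S.heap.erase u }) :=
      ⟨u, hu, hmin, rfl⟩
    obtain ⟨X', hX', hc⟩ := h.step hε hnone (fun _ _ => trivial) (fun _ _ _ _ _ _ => trivial) hs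
    obtain ⟨S', h1, h2⟩ := ih hX' (by omega)
    exact ⟨S', Relation.ReflTransGen.head hs h1, h2⟩

end Phase

/-- The invariant holds when a phase starts, if no list has an entry for this phase yet. -/
theorem PhaseInv.start {G : WDigraph V} {T : RootedTree V} {P : List V} {ε₂ : ℝ} {i j : ℕ}
    {S : PDState V} (R : V → Option V → ℝ≥0∞ → Prop) :
    PhaseInv (phaseGraph G T P i j) ε₂ j R (phaseStart P i j S) (phaseStart P i j S) ∅ where
  extracted_subset := Finset.empty_subset _
  heap_subset := by
    intro v hv
    rw [Finset.mem_singleton.1 hv]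
    exact Finset.mem_insert_self _ _
  disjoint := by simp
  source_mem := Or.inr (Finset.mem_singleton_self _)
  of_source_mem_heap := fun _ => ⟨rfl, rfl⟩
  d_source := rfl
  mono := by simp
  inactive := fun _ _ _ => ⟨rfl, rfl, rfl⟩
  upd_other := fun _ _ _ => rfl
  upd_active := by
    intro v hv hn
    rcases hv with hv | hv
    · simp at hv
    · exact absurd (Finset.mem_singleton.1 hv) hn
  relaxed := by simp
  almost_relaxed := by simp
  sound := by
    intro v hv
    rcases hv with hv | hv
    · simp at hv
    · simp [phaseStart] at hv

theorem phaseGraph_w_none (G : WDigraph V) (T : RootedTree V) (P : List V) (i j : ℕ)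
    (u : Option V) : (phaseGraph G T P i j).w u none = ⊤ := by
  cases u <;> rfl

/-- The progressive Dijkstra algorithm can be run. -/
theorem exists_isProgMainOutput (G : WDigraph V) (T : RootedTree V) (P : List V) {ε₂ : ℝ}
    (hε : 0 ≤ ε₂) (i : ℕ) : ∃ U, IsProgMainOutput G T P ε₂ i U := by
  have hex : ∀ (j : ℕ) (S : PDState V), ∃ S', PDPhase G T P ε₂ i j S S' := fun j S =>
    (PhaseInv.start _).exists_reflTransGen hε (phaseGraph_w_none G T P i j)
  choose f hf using hex
  let S : ℕ → PDState V := fun n => Nat.rec PDState.init f n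
  exact ⟨_, S, rfl, fun j _ => hf j (S j), rfl⟩

end

section

variable {V : Type u}

/-! ### The lists computed by the progressive Dijkstra algorithm -/

/-- `Detour G P b v ℓ`: there is a walk of `G` from `b` to `v` of length `ℓ` all of whose vertices
before the last one, except for `b`, are off `P`. -/
inductive Detour (G : WDigraph V) (P : List V) (b : V) : V → ℝ≥0∞ → Prop
  | nil : b ∈ G.verts → Detour G P b b 0
  | snoc {u v : V} {ℓ : ℝ≥0∞} : Detour G P b u ℓ → u = b ∨ u ∉ P → G.Adj u v →
      Detour G P b v (ℓ + G.w u v)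

theorem Detour.walk {G : WDigraph V} {P : List V} {b v : V} {ℓ : ℝ≥0∞} (h : Detour G P b v ℓ) :
    G.Walk b v ℓ := by
  induction h with
  | nil h => exact WDigraph.Walk.nil h
  | snoc _ _ ha ih => exact ih.snoc ha

theorem valueBefore_congr {e e' : ℕ → Option (ℝ≥0∞ × Option V)} {k : ℕ}
    (h : ∀ j < k, e j = e' j) : valueBefore e k = valueBefore e' k := by
  induction k with
  | zero => rfl
  | succ k ih =>
    simp only [valueBefore]
    rw [h k (Nat.lt_succ_self k), ih fun j hj => h j (hj.trans (Nat.lt_succ_self k))]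

theorem exists_entry_of_valueBefore_ne_top {e : ℕ → Option (ℝ≥0∞ × Option V)} {k : ℕ}
    (h : valueBefore e k ≠ ⊤) : ∃ j < k, ∃ β, e j = some (valueBefore e k, β) := by
  induction k with
  | zero => exact absurd rfl h
  | succ k ih =>
    simp only [valueBefore] at h ⊢
    cases hk : e k with
    | some q => exact ⟨k, Nat.lt_succ_self k, q.2, hk⟩
    | none =>
      rw [hk] at h
      obtain ⟨j, hj, β, hβ⟩ := ih h
      exact ⟨j, hj.trans (Nat.lt_succ_self k), β, hβ⟩

variable [DecidableEq V]

theorem Detour.walk_del {G : WDigraph V} {P : List V} {b v x : V} {ℓ : ℝ≥0∞}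
    (h : Detour G P b v ℓ) (hx : x ∈ P) (hb : b ≠ x) (hv : v ≠ x) : (G.del x).Walk b v ℓ := by
  induction h with
  | nil h => exact WDigraph.Walk.nil (Finset.mem_erase.2 ⟨hb, h⟩)
  | @snoc u v ℓ _ hu ha ih =>
    have hux : u ≠ x := by
      rcases hu with rfl | hu
      · exact hb
      · rintro rfl; exact hu hx
    exact (ih hux).snoc (ha.del hux hv)

/-- The meaning of an entry `(j, ℓ, β)` of the list of `v` at level `i`: the value `ℓ` is the length
of the walk that follows the tree to the vertex `β` of the `j`-th interval and then a detour to `v`,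
and `v` is not on an interval up to the `j`-th, unless it is `β`. -/
def EntrySound (G : WDigraph V) (s : V) (P : List V) (i j : ℕ) (v : V) (β : Option V)
    (ℓ : ℝ≥0∞) : Prop :=
  ∃ b, β = some b ∧ InInterval P i j b ∧ (∃ ℓ', Detour G P b v ℓ' ∧ ℓ = G.dist s b + ℓ') ∧
    (v = b ∨ ¬ ∃ j' ≤ j, InInterval P i j' v)

theorem phaseGraph_adj_none {G : WDigraph V} {T : RootedTree V} {P : List V} {i j : ℕ} {v : V}
    (h : (phaseGraph G T P i j).Adj none (some v)) : InInterval P i j v ∧ v ∈ G.verts ∧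
      (phaseGraph G T P i j).w none (some v) = T.dist G T.root v := by
  have h1 := h.2.2
  have h2 : (phaseGraph G T P i j).w none (some v) =
    if InInterval P i j v then T.dist G T.root v else ⊤ := rfl
  have h3 : InInterval P i j v := by
    by_contra hc
    exact h1 (h2.trans (if_neg hc))
  have h4 := h.2.1
  simp only [phaseGraph, Finset.mem_insert, Finset.mem_image] at h4
  refine ⟨h3, ?_, h2.trans (if_pos h3)⟩
  simpa using h4

theorem phaseGraph_adj_some {G : WDigraph V} {T : RootedTree V} {P : List V} {i j : ℕ} {u v : V} :
    (phaseGraph G T P i j).Adj (some u) (some v) ↔ G.Adj u v ∧ ¬ IsPathEdge P u v ∧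
      (¬ ∃ j' ≤ j, InInterval P i j' v) ∧ ¬ ∃ j' > j, InInterval P i j' u := by
  have h2 : (phaseGraph G T P i j).w (some u) (some v) = if IsPathEdge P u v ∨
    (∃ j' ≤ j, InInterval P i j' v) ∨ (∃ j' > j, InInterval P i j' u) then ⊤ else G.w u v := rfl
  have h3 : ∀ y, some y ∈ (phaseGraph G T P i j).verts ↔ y ∈ G.verts := fun y => by
    simp [phaseGraph]
  rw [WDigraph.Adj, h3, h3, h2]
  split_ifs with hc
  · constructor
    · intro h; exact absurd rfl h.2.2
    · rintro ⟨-, h4, h5, h6⟩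
      rcases hc with hc | hc | hc
      · exact absurd hc h4
      · exact absurd hc h5
      · exact absurd hc h6
  · rw [not_or, not_or] at hc
    exact ⟨fun h => ⟨h, hc⟩, fun h => h.1⟩

theorem phaseGraph_w_some {G : WDigraph V} {T : RootedTree V} {P : List V} {i j : ℕ} {u v : V}
    (h : (phaseGraph G T P i j).Adj (some u) (some v)) :
    (phaseGraph G T P i j).w (some u) (some v) = G.w u v := by
  obtain ⟨-, h1, h2, h3⟩ := phaseGraph_adj_some.1 h
  exact if_neg (not_or.2 ⟨h1, not_or.2 ⟨h2, h3⟩⟩)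

section Level

variable {G : WDigraph V} {T : RootedTree V} {s : V} {P : List V} {ε₂ : ℝ} {i : ℕ}

/-- The state of the algorithm between the phases, after `j` of them. -/
structure LevelInv (G : WDigraph V) (s : V) (P : List V) (i j : ℕ) (S : PDState V) : Prop where
  upd_none : ∀ v, ∀ j' ≥ j, S.upd v j' = none
  sound : ∀ v j' ℓ β, S.upd (some v) j' = some (ℓ, β) → EntrySound G s P i j' v β ℓ
  d_eq : ∀ v, S.d (some v) = valueBefore (S.upd (some v)) j

theorem PDPhase.exists_phaseInv (hT : T.IsShortestPathTree G s) (hε : 0 ≤ ε₂) {j : ℕ}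
    {S S' : PDState V} (hS : PDPhase G T P ε₂ i j S S') :
    ∃ X, PhaseInv (phaseGraph G T P i j) ε₂ j (EntrySound G s P i j) (phaseStart P i j S) S' X := by
  refine (PhaseInv.start _).of_reflTransGen hε (phaseGraph_w_none G T P i j) ?_ ?_ hS.1
  · intro v ha
    obtain ⟨h1, h2, h3⟩ := phaseGraph_adj_none ha
    refine ⟨v, if_pos h1, h1, ⟨0, Detour.nil h2, ?_⟩, Or.inl rfl⟩
    rw [h3, hT.root_eq, hT.treeDist_eq, add_zero]
  · rintro u v β ℓ ⟨b, rfl, hb, ⟨ℓ', hℓ', rfl⟩, hub⟩ ha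
    rw [phaseGraph_w_some ha]
    obtain ⟨h1, -, h3, h4⟩ := phaseGraph_adj_some.1 ha
    refine ⟨b, rfl, hb, ⟨_, hℓ'.snoc ?_ h1, add_assoc _ _ _⟩, Or.inr h3⟩
    rcases hub with hub | hub
    · exact Or.inl hub
    · refine Or.inr fun huP => ?_
      rcases le_or_gt (intervalIndex P i (P.idxOf u)) j with hle | hlt
      · exact hub ⟨_, hle, huP, rfl⟩
      · exact h4 ⟨_, hlt, huP, rfl⟩

/-- The vertices of the `j`-th interval are active in phase `j` and get their correct values: their
tentative distances were reset to `⊤`. -/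
theorem PhaseInv.of_inInterval (hT : T.IsShortestPathTree G s) {j : ℕ} {S S' : PDState V}
    {R : V → Option V → ℝ≥0∞ → Prop} {X : Finset (Option V)}
    (hX : PhaseInv (phaseGraph G T P i j) ε₂ j R (phaseStart P i j S) S' X) (hemp : S'.heap = ∅)
    {v : V} (hv : v ∈ T.verts) (hin : InInterval P i j v) :
    some v ∈ X ∧ S'.d (some v) ≤ G.dist s v := by
  have hnone : none ∈ X := by simpa [hemp] using hX.source_mem
  have hw : (phaseGraph G T P i j).w none (some v) = G.dist s v := by
    rw [← hT.treeDist_eq v, ← hT.root_eq]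
    exact if_pos hin
  have hfin := hT.dist_ne_top hv
  have hadj : (phaseGraph G T P i j).Adj none (some v) :=
    ⟨Finset.mem_insert_self _ _, Finset.mem_insert_of_mem
      (Finset.mem_image_of_mem _ (hT.subset_verts hv)), by rw [hw]; exact hfin⟩
  have hvX : some v ∈ X := by
    by_contra hvX
    have := hX.almost_relaxed none hnone (some v) hadj hvX (by simp [hemp])
    rw [hX.d_source, zero_add, hw,
      show (phaseStart P i j S).d (some v) = ⊤ from if_pos hin, top_le_iff] at this
    exact ENNReal.mul_ne_top ENNReal.ofReal_ne_top hfin this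
  refine ⟨hvX, ?_⟩
  have := hX.relaxed none hnone (some v) hadj (Or.inl hvX)
  rwa [hX.d_source, zero_add, hw] at this

theorem LevelInv.step (hT : T.IsShortestPathTree G s) (hε : 0 ≤ ε₂) {j : ℕ}
    {S S' : PDState V} (h : LevelInv G s P i j S) (hS : PDPhase G T P ε₂ i j S S')
    (hP : ∀ v ∈ P, v ∈ T.verts) :
    LevelInv G s P i (j + 1) S' ∧ ∀ v, ∀ j' ≠ j, S'.upd v j' = S.upd v j' := by
  obtain ⟨X, hX⟩ := hS.exists_phaseInv hT hε
  have hemp := hS.2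
  have hother : ∀ v, ∀ j' ≠ j, S'.upd v j' = S.upd v j' := hX.upd_other
  have hactive : ∀ v, some v ∈ X → S'.upd (some v) j = some (S'.d (some v), S'.b (some v)) :=
    fun v hv => hX.upd_active _ (Or.inl hv) (by simp)
  have hinactive : ∀ v, some v ∉ X →
      S'.d (some v) = (phaseStart P i j S).d (some v) ∧ S'.upd (some v) j = none := fun v hv => by
    obtain ⟨h1, -, h3⟩ := hX.inactive (some v) hv (by simp [hemp])
    exact ⟨h1, h3.trans (h.upd_none _ j le_rfl)⟩
  refine ⟨⟨fun v j' hj' => ?_, fun v j' ℓ β he => ?_, fun v => ?_⟩, hother⟩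
  · rw [hother v j' (by omega)]
    exact h.upd_none v j' (by omega)
  · by_cases hj : j' = j
    · subst hj
      by_cases hv : some v ∈ X
      · rw [hactive v hv, Option.some_inj, Prod.mk.injEq] at he
        obtain ⟨rfl, rfl⟩ := he
        exact hX.sound v (Or.inl hv)
      · rw [(hinactive v hv).2] at he
        exact absurd he (by simp)
    · rw [hother _ _ hj] at he
      exact h.sound v j' ℓ β he
  · by_cases hv : some v ∈ X
    · simp [valueBefore, hactive v hv]
    · obtain ⟨h1, h2⟩ := hinactive v hv
      have hnot : ¬ InInterval P i j v := fun hin =>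
        hv (hX.of_inInterval hT hemp (hP v hin.1) hin).1
      have h3 : (phaseStart P i j S).d (some v) = S.d (some v) := if_neg hnot
      simp only [valueBefore, h2]
      rw [h1, h3, h.d_eq v]
      exact valueBefore_congr fun j' hj' => (hother _ _ hj'.ne).symm

theorem LevelInv.init : LevelInv G s P i 0 PDState.init where
  upd_none := fun _ _ _ => rfl
  sound := fun _ _ _ _ he => by simp [PDState.init] at he
  d_eq := fun _ => rfl

/-- The states between the phases, together with the way in which their lists are related to the
final ones. -/
theorem IsProgMainOutput.exists_states (hT : T.IsShortestPathTree G s) (hε : 0 ≤ ε₂)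
    (hP : ∀ v ∈ P, v ∈ T.verts) {U : Option V → ℕ → Option (ℝ≥0∞ × Option V)}
    (hU : IsProgMainOutput G T P ε₂ i U) :
    ∃ S : ℕ → PDState V, (∀ j < 2 ^ i, PDPhase G T P ε₂ i j (S j) (S (j + 1))) ∧
      (∀ j ≤ 2 ^ i, LevelInv G s P i j (S j)) ∧ (S (2 ^ i)).upd = U ∧
      ∀ j ≤ 2 ^ i, ∀ v, ∀ j' < j, U v j' = (S j).upd v j' := by
  obtain ⟨S, h0, hS, rfl⟩ := hU
  have hinv : ∀ j ≤ 2 ^ i, LevelInv G s P i j (S j) := by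
    intro j
    induction j with
    | zero => intro _; rw [h0]; exact LevelInv.init
    | succ j ih => intro hj; exact ((ih (by omega)).step hT hε (hS j hj) hP).1
  refine ⟨S, hS, hinv, rfl, fun j hj v j' hj' => ?_⟩
  have key : ∀ m, j ≤ m → m ≤ 2 ^ i → (S m).upd v j' = (S j).upd v j' := by
    intro m hm
    induction m, hm using Nat.le_induction with
    | base => intro _; rfl
    | succ m hm ih =>
      intro hle
      rw [((hinv m (by omega)).step hT hε (hS m hle) hP).2 v j' (by omega)]
      exact ih (by omega)
  exact key _ hj le_rfl

theorem IsProgMainOutput.entrySound (hT : T.IsShortestPathTree G s) (hε : 0 ≤ ε₂)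
    (hP : ∀ v ∈ P, v ∈ T.verts) {U : Option V → ℕ → Option (ℝ≥0∞ × Option V)}
    (hU : IsProgMainOutput G T P ε₂ i U) {v : V} {j : ℕ} {ℓ : ℝ≥0∞} {β : Option V}
    (he : U (some v) j = some (ℓ, β)) : EntrySound G s P i j v β ℓ := by
  obtain ⟨S, -, h1, rfl, -⟩ := hU.exists_states hT hε hP
  exact (h1 _ le_rfl).sound v j ℓ β he

/-- What the `j`-th phase achieves, in terms of the values read off from the lists: the vertices of
the `j`-th interval are active and have the correct values, and an edge of `G_{i,j}` out of an active
vertex is relaxed if its head is active; otherwise the value of the head comes from the previous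
phases, and the edge is relaxed up to the factor `1 + ε₂`. -/
theorem IsProgMainOutput.exists_active (hT : T.IsShortestPathTree G s) (hε : 0 ≤ ε₂)
    (hP : ∀ v ∈ P, v ∈ T.verts) {U : Option V → ℕ → Option (ℝ≥0∞ × Option V)}
    (hU : IsProgMainOutput G T P ε₂ i U) {j : ℕ} (hj : j < 2 ^ i) :
    ∃ X : Set V, (∀ v, InInterval P i j v → v ∈ X ∧
        valueBefore (U (some v)) (j + 1) ≤ G.dist s v) ∧
      ∀ u ∈ X, ∀ v, (phaseGraph G T P i j).Adj (some u) (some v) →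
        (v ∈ X ∧ valueBefore (U (some v)) (j + 1) ≤ valueBefore (U (some u)) (j + 1) + G.w u v) ∨
        (valueBefore (U (some v)) j ≤
          ENNReal.ofReal (1 + ε₂) * (valueBefore (U (some u)) (j + 1) + G.w u v)) := by
  obtain ⟨S, hS, hinv, -, hagree⟩ := hU.exists_states hT hε hP
  have h1 := hinv j hj.le
  have h2 := hinv (j + 1) hj
  have e1 : ∀ v, valueBefore (U (some v)) j = (S j).d (some v) := fun v => by
    rw [h1.d_eq]
    exact valueBefore_congr fun j' hj' => hagree j hj.le _ j' hj'
  have e2 : ∀ v, valueBefore (U (some v)) (j + 1) = (S (j + 1)).d (some v) := fun v => by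
    rw [h2.d_eq]
    exact valueBefore_congr fun j' hj' => hagree (j + 1) hj _ j' hj'
  obtain ⟨X, hX⟩ := (hS j hj).exists_phaseInv hT hε
  have hemp := (hS j hj).2
  refine ⟨{v | some v ∈ X}, fun v hin => ?_, fun u hu v ha => ?_⟩
  · rw [e2]
    exact hX.of_inInterval hT hemp (hP v hin.1) hin
  · have hw := phaseGraph_w_some ha
    rw [e2, e2, e1]
    by_cases hv : some v ∈ X
    · have := hX.relaxed _ hu _ ha (Or.inl hv)
      rw [hw] at this
      exact Or.inl ⟨hv, this⟩
    · have := hX.almost_relaxed _ hu _ ha hv (by simp [hemp])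
      have hnot : ¬ InInterval P i j v := fun hin =>
        (phaseGraph_adj_some.1 ha).2.2.1 ⟨j, le_rfl, hin⟩
      rw [hw, show (phaseStart P i j (S j)).d (some v) = (S j).d (some v) from if_neg hnot] at this
      exact Or.inr this

end Level

end

section

variable {V : Type u}

/-! ### The DP-oracle -/

theorem mem_verts_of_mem_rootPath {T : RootedTree V} {z : V} (hz : z ∈ T.verts) {v : V} (hv : v ∈ T.rootPath z) :
    v ∈ T.verts := ((RootedTree.mem_rootPath hz).1 hv).mem_left

theorem depth_lt_two_pow_levels {T : RootedTree V} {z : V} (hz : z ∈ T.verts) {v : V} (hv : v ∈ T.rootPath z) :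
    T.depth v < 2 ^ levels (T.rootPath z) := by
  have h1 := ((RootedTree.mem_rootPath hz).1 hv).depth_le
  have h2 := Nat.le_pow_clog (b := 2) (by norm_num) (T.rootPath z).length
  rw [RootedTree.length_rootPath] at h2
  unfold levels
  rw [RootedTree.length_rootPath]
  omega

section DP

variable [DecidableEq V]

variable {G : WDigraph V} {T : RootedTree V} {s z : V} {ε₂ : ℝ}
  {upd : ℕ → Option V → ℕ → Option (ℝ≥0∞ × Option V)}

theorem intervalIndex_rootPath (hz : z ∈ T.verts) {v : V} (hv : v ∈ T.rootPath z) (i : ℕ) :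
    intervalIndex (T.rootPath z) i ((T.rootPath z).idxOf v) =
      T.depth v / 2 ^ (levels (T.rootPath z) - i) := by
  rw [intervalIndex, RootedTree.idxOf_rootPath hz hv]

theorem lt_of_div_lt_div {a b c : ℕ} (h : a / c < b / c) : a < b :=
  lt_of_not_ge fun hle => absurd (Nat.div_le_div_right (c := c) hle) (not_le.2 h)

/-- Following the tree to a vertex before `x` on the path `P` and then a detour avoids `x`. -/
theorem Detour.dist_del_le (hT : T.IsShortestPathTree G s) {b v x : V}
    {ℓ : ℝ≥0∞} (h : Detour G (T.rootPath z) b v ℓ) (hx : x ∈ T.rootPath z)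
    (hbx : T.depth b < T.depth x) (hv : v ≠ x) :
    (G.del x).dist s v ≤ G.dist s b + ℓ := by
  refine ((G.del x).dist_triangle s b v).trans ?_
  rw [hT.dist_del_eq fun ha => absurd ha.depth_le (not_le.2 hbx)]
  gcongr
  exact WDigraph.dist_le_of_walk (h.walk_del hx (fun e => by simp [e] at hbx) hv)

theorem dist_del_le_dpQuery (hT : T.IsShortestPathTree G s) (hz : z ∈ T.verts) (hε : 0 ≤ ε₂)
    (hupd : ∀ i ≤ levels (T.rootPath z), IsProgMainOutput G T (T.rootPath z) ε₂ i (upd i))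
    {x t : V} (hxt : t ≠ x) : (G.del x).dist s t ≤ dpQuery (T.rootPath z) upd x t := by
  by_cases hx : x ∈ T.rootPath z
  swap
  · simp [dpQuery, hx]
  rw [dpQuery, if_pos hx]
  refine Finset.le_inf fun i hi => ?_
  by_cases htop : valueBefore (upd i (some t))
      (intervalIndex (T.rootPath z) i ((T.rootPath z).idxOf x)) = ⊤
  · simp [htop]
  obtain ⟨j, hj, β, he⟩ := exists_entry_of_valueBefore_ne_top htop
  obtain ⟨b, -, hb, ⟨ℓ', hℓ, hval⟩, -⟩ := (hupd i (Finset.mem_range_succ_iff.1 hi)).entrySound hT hε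
    (fun v hv => mem_verts_of_mem_rootPath hz hv) he
  rw [hval]
  rw [← hb.2, intervalIndex_rootPath hz hb.1, intervalIndex_rootPath hz hx] at hj
  exact hℓ.dist_del_le hT hx (lt_of_div_lt_div hj) hxt

/-- Suppose that `x` comes later on `P` than the vertex `b`, and even in a later interval of level
`i`. Then some level yields for `v` a value that is larger than the length of a given detour from `b`
by a factor of at most `(1 + ε₂) ^ i`.

If the intervals of level `i` that contain `b` and `x` are not siblings, level `i - 1` will do. If
they are, the phase of the interval of `b` follows the detour until it meets a vertex `y` that it does
not activate. At that vertex the value from the previous phases is at most `1 + ε₂` times too large; it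
belongs to a detour from a vertex `b'` in an earlier interval, and this detour, continued by the rest
of the given one, is dealt with at level `i - 1`, where `b'` and `x` lie in different intervals. -/
theorem exists_valueBefore_le (hT : T.IsShortestPathTree G s) (hz : z ∈ T.verts) (hε : 0 ≤ ε₂)
    (hupd : ∀ i ≤ levels (T.rootPath z), IsProgMainOutput G T (T.rootPath z) ε₂ i (upd i))
    {x : V} (hx : x ∈ T.rootPath z) {i : ℕ} (hi : i ≤ levels (T.rootPath z)) {b v : V} {ℓ : ℝ≥0∞}
    (hb : b ∈ T.rootPath z)
    (hbx : T.depth b / 2 ^ (levels (T.rootPath z) - i) <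
      T.depth x / 2 ^ (levels (T.rootPath z) - i))
    (h : Detour G (T.rootPath z) b v ℓ) (hv : v ∈ T.rootPath z → T.depth x < T.depth v) :
    ∃ i' ≤ levels (T.rootPath z), valueBefore (upd i' (some v))
        (intervalIndex (T.rootPath z) i' ((T.rootPath z).idxOf x)) ≤
      ENNReal.ofReal (1 + ε₂) ^ i * (G.dist s b + ℓ) := by
  have hone := one_le_ofReal hε
  have hPT : ∀ v ∈ T.rootPath z, v ∈ T.verts := fun v hv => mem_verts_of_mem_rootPath hz hv
  induction i generalizing b v ℓ with
  | zero =>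
    rw [Nat.sub_zero, Nat.div_eq_of_lt (depth_lt_two_pow_levels hz hx)] at hbx
    exact absurd hbx (Nat.not_lt_zero _)
  | succ i ih =>
    by_cases hib : T.depth b / 2 ^ (levels (T.rootPath z) - i) <
        T.depth x / 2 ^ (levels (T.rootPath z) - i)
    · obtain ⟨i', h1, h2⟩ := ih (by omega) hb hib h hv
      refine ⟨i', h1, h2.trans ?_⟩
      gcongr ?_ * _
      exact pow_le_pow_right₀ hone (Nat.le_succ i)
    have hdb := depth_lt_two_pow_levels hz hb
    have hlevel : levels (T.rootPath z) - i = levels (T.rootPath z) - (i + 1) + 1 := by omega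
    have htotal : 2 ^ levels (T.rootPath z) =
        2 ^ (levels (T.rootPath z) - (i + 1)) * 2 ^ (i + 1) := by
      rw [← pow_add]
      congr 1
      omega
    have hindex := fun y (hy : y ∈ T.rootPath z) => intervalIndex_rootPath hz hy (i + 1)
    rw [hlevel, pow_succ, ← Nat.div_div_eq_div_mul, ← Nat.div_div_eq_div_mul] at hib
    simp only [hlevel, pow_succ, ← Nat.div_div_eq_div_mul] at ih
    have hltx := lt_of_div_lt_div hbx
    generalize 2 ^ (levels (T.rootPath z) - (i + 1)) = σ at *
    generalize hj : T.depth b / σ = j at *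
    have hdx : T.depth x / σ = j + 1 := by omega
    have hj2 : j < 2 ^ (i + 1) := by
      rw [← hj]
      exact Nat.div_lt_of_lt_mul (htotal ▸ hdb)
    obtain ⟨X, hX1, hX2⟩ := (hupd (i + 1) hi).exists_active hT hε hPT hj2
    obtain ⟨hbX, hbval⟩ := hX1 b ⟨hb, (hindex b hb).trans hj⟩
    have key : ∀ {v ℓ}, Detour G (T.rootPath z) b v ℓ →
        (v ∈ T.rootPath z → v = b ∨ T.depth x < T.depth v) →
        (v ∈ X ∧ valueBefore (upd (i + 1) (some v)) (j + 1) ≤ G.dist s b + ℓ) ∨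
        ∃ b' ∈ T.rootPath z, T.depth b' / σ < j ∧ ∃ ℓ', Detour G (T.rootPath z) b' v ℓ' ∧
          G.dist s b' + ℓ' ≤ ENNReal.ofReal (1 + ε₂) * (G.dist s b + ℓ) := by
      intro v ℓ h
      induction h with
      | nil _ => intro _; exact Or.inl ⟨hbX, by simpa using hbval⟩
      | @snoc u v ℓ hd hu ha ihd =>
        intro hv
        by_cases hvb : v = b
        · subst hvb
          exact Or.inl ⟨hbX, hbval.trans le_self_add⟩
        have hu' : (u ∈ X ∧ valueBefore (upd (i + 1) (some u)) (j + 1) ≤ G.dist s b + ℓ) ∨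
            u ∉ T.rootPath z ∧
            ∃ b' ∈ T.rootPath z, T.depth b' / σ < j ∧ ∃ ℓ', Detour G (T.rootPath z) b' u ℓ' ∧
              G.dist s b' + ℓ' ≤ ENNReal.ofReal (1 + ε₂) * (G.dist s b + ℓ) := by
          rcases hu with rfl | hu
          · exact Or.inl ⟨hbX, hbval.trans le_self_add⟩
          · exact (ihd fun h => absurd h hu).imp_right fun h => ⟨hu, h⟩
        rcases hu' with ⟨huX, huval⟩ | ⟨huP, b', hb', hb'j, ℓ', hℓ', hle⟩
        · have hadj : (phaseGraph G T (T.rootPath z) (i + 1) j).Adj (some u) (some v) := by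
            refine phaseGraph_adj_some.2 ⟨ha, ?_, ?_, ?_⟩
            · rintro ⟨k, hk1, hk2⟩
              rw [RootedTree.rootPath_getElem? hz] at hk1 hk2
              have h1 := (hv ((RootedTree.mem_rootPath hz).2 hk2.1)).resolve_left hvb
              rcases hu with rfl | hu
              · omega
              · exact hu ((RootedTree.mem_rootPath hz).2 hk1.1)
            · rintro ⟨j', hj', hvP, hvj⟩
              rw [hindex v hvP] at hvj
              have h1 := Nat.div_le_div_right (c := σ) ((hv hvP).resolve_left hvb).le
              omega
            · rintro ⟨j', hj', huP, huj⟩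
              rcases hu with rfl | hu
              · rw [hindex u huP] at huj
                omega
              · exact hu huP
          rcases hX2 u huX v hadj with ⟨hvX, hval⟩ | hval
          · left
            refine ⟨hvX, hval.trans ?_⟩
            rw [← add_assoc]
            gcongr
          · right
            have hval' : valueBefore (upd (i + 1) (some v)) j ≤
                ENNReal.ofReal (1 + ε₂) * (G.dist s b + (ℓ + G.w u v)) := by
              refine hval.trans ?_
              rw [← add_assoc]
              gcongr
            have hfin : valueBefore (upd (i + 1) (some v)) j ≠ ⊤ :=
              ne_top_of_le_ne_top (ENNReal.mul_ne_top ENNReal.ofReal_ne_top (ENNReal.add_ne_top.2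
                ⟨hT.dist_ne_top (hPT b hb), (hd.snoc hu ha).walk.ne_top⟩)) hval'
            obtain ⟨j', hj', β, he⟩ := exists_entry_of_valueBefore_ne_top hfin
            obtain ⟨b', -, hb', ⟨ℓ', hℓ', hvl⟩, -⟩ := (hupd (i + 1) hi).entrySound hT hε hPT he
            refine ⟨b', hb'.1, ?_, ℓ', hℓ', hvl ▸ hval'⟩
            rw [← hindex b' hb'.1, hb'.2]
            exact hj'
        · right
          refine ⟨b', hb', hb'j, _, hℓ'.snoc (Or.inr huP) ha, ?_⟩
          rw [← add_assoc, ← add_assoc, mul_add]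
          gcongr
          exact le_mul_of_one_le_left' hone
    rcases key h (fun h => Or.inr (hv h)) with ⟨-, hval⟩ | ⟨b', hb', hb'j, ℓ', hℓ', hle⟩
    · refine ⟨i + 1, hi, ?_⟩
      rw [hindex x hx, hdx]
      exact hval.trans (le_mul_of_one_le_left' (one_le_pow₀ hone))
    · -- `j` is even, so that `b'` and `x` are in different intervals of level `i`
      obtain ⟨i', h1, h2⟩ := ih (by omega) hb' (by omega) hℓ' hv
      refine ⟨i', h1, h2.trans ?_⟩
      rw [pow_succ, mul_assoc]
      gcongr

/-- The DP-oracle finds, up to a factor, all replacement paths that never return to `P`. -/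
theorem exists_valueBefore_le_of_depth_lt (hT : T.IsShortestPathTree G s) (hz : z ∈ T.verts)
    (hε : 0 ≤ ε₂)
    (hupd : ∀ i ≤ levels (T.rootPath z), IsProgMainOutput G T (T.rootPath z) ε₂ i (upd i))
    {x : V} (hx : x ∈ T.rootPath z) {b v : V} {ℓ : ℝ≥0∞} (hb : b ∈ T.rootPath z)
    (hbx : T.depth b < T.depth x) (h : Detour G (T.rootPath z) b v ℓ)
    (hv : v ∈ T.rootPath z → T.depth x < T.depth v) :
    ∃ i ≤ levels (T.rootPath z), valueBefore (upd i (some v))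
        (intervalIndex (T.rootPath z) i ((T.rootPath z).idxOf x)) ≤
      ENNReal.ofReal (1 + ε₂) ^ levels (T.rootPath z) * (G.dist s b + ℓ) :=
  exists_valueBefore_le hT hz hε hupd hx le_rfl hb (by simpa using hbx) h hv

theorem dpQuery_le (hT : T.IsShortestPathTree G s) (hz : z ∈ T.verts) (hε : 0 ≤ ε₂)
    (hupd : ∀ i ≤ levels (T.rootPath z), IsProgMainOutput G T (T.rootPath z) ε₂ i (upd i))
    {x : V} (hx : x ∈ T.rootPath z) {b v : V} {ℓ : ℝ≥0∞} (hb : b ∈ T.rootPath z)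
    (hbx : T.depth b < T.depth x) (h : Detour G (T.rootPath z) b v ℓ)
    (hv : v ∈ T.rootPath z → T.depth x < T.depth v) :
    dpQuery (T.rootPath z) upd x v ≤
      ENNReal.ofReal (1 + ε₂) ^ levels (T.rootPath z) * (G.dist s b + ℓ) := by
  obtain ⟨i, hi, hle⟩ := exists_valueBefore_le_of_depth_lt hT hz hε hupd hx hb hbx h hv
  rw [dpQuery, if_pos hx]
  exact (Finset.inf_le (Finset.mem_range_succ_iff.2 hi)).trans hle

/-- A walk that avoids a vertex `x` of `P` can be assumed to follow `P` up to a vertex `b` before `x`,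
and then either it does not return to `P`, or it returns first at a vertex `y` after `x`, and does not
meet the part of `P` before `x` any more. -/
theorem walk_del_decomposition (hT : T.IsShortestPathTree G s) (hz : z ∈ T.verts) {x v : V}
    (hx : x ∈ T.rootPath z) (hxs : x ≠ s) {ℓ : ℝ≥0∞} (h : (G.del x).Walk s v ℓ) :
    ∃ b ∈ T.rootPath z, T.depth b < T.depth x ∧
      ((∃ ℓ', Detour G (T.rootPath z) b v ℓ' ∧ G.dist s b + ℓ' ≤ ℓ ∧
          (v ∈ T.rootPath z → v = b)) ∨
        ∃ y ∈ T.rootPath z, T.depth x < T.depth y ∧ ∃ ℓ₁ ℓ₂, Detour G (T.rootPath z) b y ℓ₁ ∧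
          (G.del x).Walk y v ℓ₂ ∧ G.dist s b + ℓ₁ + ℓ₂ ≤ ℓ) := by
  have hxz := (RootedTree.mem_rootPath hz).1 hx
  have hroot := hT.root_eq
  induction h with
  | nil hs =>
    have hsz : T.IsAncestor s z := hroot ▸ RootedTree.isAncestor_root hz
    have hsP := (RootedTree.mem_rootPath hz).2 hsz
    have hsG := Finset.mem_of_mem_erase hs
    have hsx : T.IsAncestor s x := hroot ▸ RootedTree.isAncestor_root hxz.mem_left
    exact ⟨s, hsP, hsx.depth_lt hxs.symm, Or.inl ⟨0, Detour.nil hsG,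
      by simp [WDigraph.dist_self hsG], fun _ => rfl⟩⟩
  | @snoc u v ℓ hw ha ih =>
    obtain ⟨haG, hux, hvx⟩ := ha.of_del
    have hvw : (G.del x).w u v = G.w u v := rfl
    by_cases hv : v ∈ T.rootPath z ∧ T.depth v < T.depth x
    · refine ⟨v, hv.1, hv.2, Or.inl ⟨0, Detour.nil haG.2.1, ?_, fun _ => rfl⟩⟩
      rw [add_zero]
      exact (G.dist_le_dist_del x s v).trans (WDigraph.dist_le_of_walk (hw.snoc ha))
    obtain ⟨b, hb, hbx, h | ⟨y, hy, hxy, ℓ₁, ℓ₂, h1, h2, h3⟩⟩ := ih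
    · obtain ⟨ℓ', hd, hle, hu⟩ := h
      have hd' := hd.snoc (or_iff_not_imp_right.2 fun h => hu (not_not.1 h)) haG
      have hle' : G.dist s b + (ℓ' + G.w u v) ≤ ℓ + (G.del x).w u v := by
        rw [← add_assoc, hvw]
        gcongr
      refine ⟨b, hb, hbx, ?_⟩
      by_cases hvP : v ∈ T.rootPath z
      · right
        have hlt : T.depth x < T.depth v := by
          by_contra hnot
          have h4 : T.depth v = T.depth x := by
            have : ¬ T.depth v < T.depth x := fun h => hv ⟨hvP, h⟩
            omega
          have hvz := (RootedTree.mem_rootPath hz).1 hvP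
          exact hvx ((hvz.of_depth_le hxz h4.le).eq_of_depth_le h4.ge)
        exact ⟨v, hvP, hlt, _, 0, hd', WDigraph.Walk.nil ha.2.1, by simpa using hle'⟩
      · exact Or.inl ⟨_, hd', hle', fun h => absurd h hvP⟩
    · refine ⟨b, hb, hbx, Or.inr ⟨y, hy, hxy, ℓ₁, _, h1, h2.snoc ha, ?_⟩⟩
      rw [← add_assoc]
      gcongr

end DP

end

section

variable {V : Type u} [DecidableEq V]

/-! ### Distances in the graphs of the recursion -/

section Recursion

variable {G : WDigraph V} {T : RootedTree V} {s z : V} {A B : Finset V} {ε₂ : ℝ}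
  {upd : ℕ → Option V → ℕ → Option (ℝ≥0∞ × Option V)}

theorem incident_adj {U : Finset V} {u v : V} :
    (G.incident U).Adj u v ↔ G.Adj u v ∧ (u ∈ U ∨ v ∈ U) := by
  have h : (G.incident U).w u v = if u ∈ U ∨ v ∈ U then G.w u v else ⊤ := rfl
  rw [WDigraph.Adj, WDigraph.Adj, h]
  split_ifs with hc
  · exact ⟨fun h => ⟨h, hc⟩, fun h => h.1⟩
  · exact ⟨fun h => absurd rfl h.2.2, fun h => absurd h.2 hc⟩

theorem incident_w {U : Finset V} {u v : V} (h : u ∈ U ∨ v ∈ U) :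
    (G.incident U).w u v = G.w u v := if_pos h

/-- The walks of a subgraph `K` that pass through `x` need not be considered, if the out-neighbours
of `x` in `K` can be reached equally fast without `x`. -/
theorem dist_del_le_of_subgraph {K : WDigraph V} {a x v : V} (ha : a ∈ G.verts) (hax : a ≠ x)
    (hK : ∀ u v, K.Adj u v → G.Adj u v ∧ G.w u v ≤ K.w u v)
    (hx : ∀ v, K.Adj x v → (G.del x).dist a v ≤ G.dist a v) (hv : v ≠ x) :
    (G.del x).dist a v ≤ K.dist a v := by
  have key := K.le_add_dist_of_potential
    (fun y => if y = x then G.dist a x else (G.del x).dist a y) ?_ a v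
  · simp only [hv, hax, if_false] at key
    rwa [WDigraph.dist_self (Finset.mem_erase.2 ⟨hax, ha⟩), zero_add] at key
  · intro y y' hadj
    obtain ⟨hG, hw⟩ := hK y y' hadj
    by_cases hy' : y' = x
    · subst hy'
      simp only [if_true]
      refine (WDigraph.dist_le_dist_add_weight hG).trans ?_
      gcongr
      split_ifs with hy
      · rw [hy]
      · exact G.dist_le_dist_del _ _ _
    · by_cases hy : y = x
      · subst hy
        simp only [hy', if_false, if_true]
        refine (hx y' hadj).trans ((WDigraph.dist_le_dist_add_weight hG).trans ?_)
        gcongr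
      · simp only [hy', hy, if_false]
        refine (WDigraph.dist_le_dist_add_weight (hG.del hy hy')).trans ?_
        gcongr
        exact hw

theorem dist_del_le_incident_right (hT : T.IsShortestPathTree G s)
    (hAB : T.IsCentroidBipartition z A B) {x v : V} (hx : x ∈ A) (hxz : x ≠ z) (hv : v ≠ x) :
    (G.del x).dist z v ≤ (G.incident B).dist z v := by
  have hxB : x ∉ B := fun h => hxz (hAB.eq_of_mem hx h)
  have hz := hAB.subset_left hAB.mem_left
  refine dist_del_le_of_subgraph (hT.subset_verts hz) hxz.symm (fun u v h => ?_) (fun v h => ?_) hv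
  · obtain ⟨h1, h2⟩ := incident_adj.1 h
    exact ⟨h1, (incident_w h2).ge⟩
  · have hvB := (incident_adj.1 h).2.resolve_left hxB
    have h1 := hT.dist_add_dist_del_le (x := x) (hAB.isAncestor_right hvB) fun h =>
      hxB (hAB.mem_right_of_isAncestor h.1 h.2 hvB)
    exact (ENNReal.add_le_add_iff_left (hT.dist_ne_top hz)).1 (h1.trans (G.dist_triangle s z v))

theorem dist_del_le_incident_left (hT : T.IsShortestPathTree G s)
    (hAB : T.IsCentroidBipartition z A B) {x v : V} (hx : x ∈ B) (hxz : x ≠ z) (hv : v ≠ x) :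
    (G.del x).dist s v ≤ (G.incident A).dist s v := by
  have hxA : x ∉ A := fun h => hxz (hAB.eq_of_mem h hx)
  have hsA : s ∈ A := hT.root_eq ▸ hAB.root_mem
  refine dist_del_le_of_subgraph (hT.subset_verts (hAB.subset_left hsA)) (fun e => hxA (e ▸ hsA))
    (fun u v h => ?_) (fun v h => ?_) hv
  · obtain ⟨h1, h2⟩ := incident_adj.1 h
    exact ⟨h1, (incident_w h2).ge⟩
  · have hvA := (incident_adj.1 h).2.resolve_left hxA
    exact (hT.dist_del_eq fun h => hxA (hAB.mem_left_of_isAncestor hvA h)).le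

/-! ### The graph `G₂` -/

theorem dist_del_le_dist_graph₂ (hT : T.IsShortestPathTree G s)
    (hAB : T.IsCentroidBipartition z A B) {x t : V} (hx : x ∈ B) (hxz : x ≠ z) :
    (G.del x).dist s t ≤ ((graph₂ G s z A B).del x).dist s t := by
  have hxA : x ∉ A := fun h => hxz (hAB.eq_of_mem h hx)
  have hsA : s ∈ A := hT.root_eq ▸ hAB.root_mem
  have hsx : s ≠ x := fun e => hxA (e ▸ hsA)
  have hs0 := WDigraph.dist_self (H := G.del x)
    (Finset.mem_erase.2 ⟨hsx, hT.subset_verts (hAB.subset_left hsA)⟩)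
  have key := ((graph₂ G s z A B).del x).le_add_dist_of_potential
    (fun y => (G.del x).dist s y) ?_ s t
  · rwa [hs0, zero_add] at key
  · intro u v ha
    obtain ⟨ha', hux, hvx⟩ := ha.of_del
    have hw : (graph₂ G s z A B).w u v =
      if v = s then ⊤ else if u = s then (G.incident A).dist s v else G.w u v := rfl
    have hmem : ∀ y ∈ (graph₂ G s z A B).verts, y ≠ s → y ∈ G.verts := fun y hy hys =>
      hT.subset_verts (hAB.subset_right (Finset.mem_of_mem_erase
        ((Finset.mem_insert.1 hy).resolve_left hys)))
    have h1 := ha'.2.2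
    change (G.del x).dist s v ≤ (G.del x).dist s u + (graph₂ G s z A B).w u v
    rw [hw] at h1 ⊢
    split_ifs at h1 ⊢ with hvs hus
    · exact absurd rfl h1
    · exact (dist_del_le_incident_left hT hAB hx hxz hvx).trans le_add_self
    · have hG : G.Adj u v := ⟨hmem u ha'.1 hus, hmem v ha'.2.1 hvs, h1⟩
      exact WDigraph.dist_le_dist_add_weight (hG.del hux hvx)

theorem dist_graph₂_le (hT : T.IsShortestPathTree G s) (hAB : T.IsCentroidBipartition z A B)
    {x v : V} {ℓ : ℝ≥0∞} (h : (G.del x).Walk s v ℓ) (hx : x ∈ B) (hxz : x ≠ z)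
    (hv : v ∈ B.erase z) : ((graph₂ G s z A B).del x).dist s v ≤ ℓ := by
  have hsA : s ∈ A := hT.root_eq ▸ hAB.root_mem
  have hsB : s ∉ B.erase z := fun h =>
    (Finset.mem_erase.1 h).1 (hAB.eq_of_mem hsA (Finset.mem_of_mem_erase h))
  have hsx : s ≠ x := by
    rintro rfl
    exact hsB (Finset.mem_erase.2 ⟨hxz, hx⟩)
  have hsT := hAB.subset_left hsA
  induction h with
  | nil _ => exact absurd hv hsB
  | @snoc u v ℓ hw ha ih =>
    obtain ⟨haG, hux, hvx⟩ := ha.of_del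
    have hvs : v ≠ s := fun e => hsB (e ▸ hv)
    have hv2 : v ∈ ((graph₂ G s z A B).del x).verts :=
      Finset.mem_erase.2 ⟨hvx, Finset.mem_insert_of_mem hv⟩
    have hdu : G.dist s u ≤ ℓ := (G.dist_le_dist_del x s u).trans (WDigraph.dist_le_of_walk hw)
    have huT := hT.mem_verts_of_dist (ne_top_of_le_ne_top hw.ne_top hdu)
    by_cases hu : u ∈ B.erase z
    · have hus : u ≠ s := fun e => hsB (e ▸ hu)
      have hwe : ((graph₂ G s z A B).del x).w u v = G.w u v := (if_neg hvs).trans (if_neg hus)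
      have hadj : ((graph₂ G s z A B).del x).Adj u v :=
        ⟨Finset.mem_erase.2 ⟨hux, Finset.mem_insert_of_mem hu⟩, hv2, by rw [hwe]; exact haG.2.2⟩
      refine (WDigraph.dist_le_dist_add_weight hadj).trans ?_
      rw [hwe]
      gcongr
      · exact ih hu
      · exact le_rfl
    · have huA : u ∈ A := by
        rcases hAB.mem_or_mem huT with h | h
        · exact h
        · by_cases huz : u = z
          · exact huz ▸ hAB.mem_left
          · exact absurd (Finset.mem_erase.2 ⟨huz, h⟩) hu
      have hwe : ((graph₂ G s z A B).del x).w s v = (G.incident A).dist s v :=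
        (if_neg hvs).trans (if_pos rfl)
      have h1 := hT.dist_add_dist_le (hT.root_eq ▸ RootedTree.isAncestor_root huT) (G.incident A)
        (hT.subset_verts hsT) fun y hy _ _ hyu => ⟨hT.subset_verts hy,
          (incident_w (Or.inr (hAB.mem_left_of_isAncestor huA hyu))).le⟩
      calc ((graph₂ G s z A B).del x).dist s v ≤ ((graph₂ G s z A B).del x).w s v :=
            WDigraph.dist_le_weight (Finset.mem_erase.2 ⟨hsx, Finset.mem_insert_self _ _⟩) hv2
        _ = (G.incident A).dist s v := hwe
        _ ≤ (G.incident A).dist s u + (G.incident A).w u v :=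
            WDigraph.dist_le_dist_add_weight (incident_adj.2 ⟨haG, Or.inl huA⟩)
        _ ≤ ℓ + (G.del x).w u v := by
            rw [incident_w (Or.inl huA)]
            gcongr
            · exact (le_add_self.trans h1).trans hdu
            · exact le_rfl

/-! ### The graph `G₁` -/

theorem dist_del_le_dist_graph₁ (hT : T.IsShortestPathTree G s)
    (hAB : T.IsCentroidBipartition z A B) (hε : 0 ≤ ε₂)
    (hupd : ∀ i ≤ levels (T.rootPath z), IsProgMainOutput G T (T.rootPath z) ε₂ i (upd i))
    {x t : V} (hx : x ∈ A) (hxs : x ≠ s) :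
    (G.del x).dist s t ≤ ((graph₁ G T z A B upd).del x).dist s t := by
  have hsA : s ∈ A := hT.root_eq ▸ hAB.root_mem
  have hz := hAB.subset_left hAB.mem_left
  have hs0 := WDigraph.dist_self (H := G.del x)
    (Finset.mem_erase.2 ⟨hxs.symm, hT.subset_verts (hAB.subset_left hsA)⟩)
  have key := ((graph₁ G T z A B upd).del x).le_add_dist_of_potential
    (fun y => (G.del x).dist s y) ?_ s t
  · rwa [hs0, zero_add] at key
  · intro u v ha
    obtain ⟨ha', hux, hvx⟩ := ha.of_del
    change (G.del x).dist s v ≤ (G.del x).dist s u +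
      min (G.w u v) (min (weightF₁ G z B u v) (weightF₂ G T (T.rootPath z) upd u v))
    rw [← min_add_add_left, ← min_add_add_left]
    refine le_min ?_ (le_min ?_ ?_)
    · by_cases htop : G.w u v = ⊤
      · simp [htop]
      · have hG : G.Adj u v := ⟨hT.subset_verts (hAB.subset_left ha'.1),
          hT.subset_verts (hAB.subset_left ha'.2.1), htop⟩
        exact WDigraph.dist_le_dist_add_weight (hG.del hux hvx)
    · unfold weightF₁
      split_ifs with hc
      · obtain ⟨rfl, -⟩ := hc
        refine ((G.del x).dist_triangle s u v).trans ?_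
        gcongr
        exact dist_del_le_incident_right hT hAB hx hux.symm hvx
      · simp
    · unfold weightF₂
      split_ifs with hc
      · rw [← tsub_le_iff_left]
        refine le_iInf₂ fun i hi => le_iInf fun j => le_iInf fun ℓ => le_iInf fun he => ?_
        obtain ⟨b, hb, hbI, ⟨ℓ', hd, rfl⟩, -⟩ := (hupd i hi).entrySound hT hε
          (fun v hv => mem_verts_of_mem_rootPath hz hv) he
        obtain rfl := Option.some_inj.1 hb
        rw [hT.root_eq, hT.treeDist_eq, ENNReal.add_sub_cancel_left
          (hT.dist_ne_top (hAB.subset_left ha'.1)), tsub_le_iff_left]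
        by_cases hxP : x ∈ T.rootPath z
        · refine ((G.del x).dist_triangle s u v).trans ?_
          gcongr
          exact WDigraph.dist_le_of_walk (hd.walk_del hxP hux hvx)
        · have hvz := (RootedTree.mem_rootPath hz).1 hc.1
          rw [hT.dist_del_eq fun h => hxP ((RootedTree.mem_rootPath hz).2 (h.trans hvz))]
          refine (G.dist_triangle s u v).trans ?_
          gcongr
          · exact G.dist_le_dist_del x s u
          · exact WDigraph.dist_le_of_walk hd.walk
      · simp

theorem graph₁_w_le (u v : V) : (graph₁ G T z A B upd).w u v ≤ G.w u v := min_le_left _ _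

/-- If the part of the tree path to `z` from `y` on avoids `x`, distances from `y` in `G - x` to
vertices of `T₁` are not increased in `G₁ - x`: the part of a walk up to its last vertex in `T₂` can
be replaced by the tree path to `z` and an edge of `F₁`. -/
theorem dist_graph₁_le (hT : T.IsShortestPathTree G s) (hAB : T.IsCentroidBipartition z A B)
    {x y v : V} {ℓ : ℝ≥0∞} (hy : T.IsAncestor y z) (hyx : ¬ (T.IsAncestor y x ∧ T.IsAncestor x z))
    (h : (G.del x).Walk y v ℓ) (hv : v ∈ A) :
    ((graph₁ G T z A B upd).del x).dist y v ≤ ℓ := by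
  set K := (graph₁ G T z A B upd).del x with hK
  have hz := hAB.subset_left hAB.mem_left
  have hzx : z ≠ x := fun e => hyx (e ▸ ⟨hy, RootedTree.IsAncestor.refl hz⟩)
  have hyA := hAB.mem_left_of_isAncestor hAB.mem_left hy
  have hyne : y ≠ x := Finset.ne_of_mem_erase h.mem_left
  have hyK : y ∈ K.verts := Finset.mem_erase.2 ⟨hyne, hyA⟩
  have hzK : z ∈ K.verts := Finset.mem_erase.2 ⟨hzx, hAB.mem_left⟩
  have hyfin := hT.dist_ne_top hy.mem_left
  have htree : G.dist s y + K.dist y z ≤ G.dist s z := by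
    refine hT.dist_add_dist_le hy K hyK fun w hw _ hyw hwz =>
      ⟨Finset.mem_erase.2 ⟨?_, hAB.mem_left_of_isAncestor hAB.mem_left hwz⟩, graph₁_w_le _ _⟩
    rintro rfl
    exact hyx ⟨hyw.trans (RootedTree.isAncestor_parent hw), hwz⟩
  induction h with
  | nil _ => exact (WDigraph.dist_self hyK).le
  | @snoc u v ℓ hw ha ih =>
    obtain ⟨haG, hux, hvx⟩ := ha.of_del
    have hvK : v ∈ K.verts := Finset.mem_erase.2 ⟨hvx, hv⟩
    have hdu : G.dist y u ≤ ℓ := (G.dist_le_dist_del x y u).trans (WDigraph.dist_le_of_walk hw)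
    have hsu : G.dist s u ≤ G.dist s y + ℓ := (G.dist_triangle s y u).trans (by gcongr)
    have huT := hT.mem_verts_of_dist
      (ne_top_of_le_ne_top (ENNReal.add_ne_top.2 ⟨hyfin, hw.ne_top⟩) hsu)
    by_cases huA : u ∈ A
    · have hadj : K.Adj u v := ⟨Finset.mem_erase.2 ⟨hux, huA⟩, hvK,
        ne_top_of_le_ne_top haG.2.2 (graph₁_w_le u v)⟩
      refine (WDigraph.dist_le_dist_add_weight hadj).trans ?_
      gcongr
      · exact ih huA
      · exact graph₁_w_le u v
    have huB := (hAB.mem_or_mem huT).resolve_left huA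
    by_cases hvz : v = z
    · subst hvz
      rw [← ENNReal.add_le_add_iff_left hyfin]
      refine htree.trans ((WDigraph.dist_le_dist_add_weight haG).trans ?_)
      rw [← add_assoc]
      gcongr
      exact le_rfl
    · have h1 := hT.dist_add_dist_le (hAB.isAncestor_right huB) (G.incident B)
        (hT.subset_verts hz) fun w hw' _ hzw hwu => ⟨hT.subset_verts hw',
          (incident_w (Or.inr (hAB.mem_right_of_isAncestor
            (hzw.trans (RootedTree.isAncestor_parent hw')) hwu huB))).le⟩
      have h2 : K.dist y z + (G.incident B).dist z u ≤ ℓ := by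
        rw [← ENNReal.add_le_add_iff_left hyfin]
        refine le_trans ?_ hsu
        rw [← add_assoc]
        exact le_trans (by gcongr) h1
      have h3 : K.w z v ≤ (G.incident B).dist z v := by
        refine ((min_le_right _ _).trans (min_le_left _ _)).trans ?_
        exact (if_pos ⟨rfl, hvz⟩ : weightF₁ G z B z v = (G.incident B).dist z v).le
      calc K.dist y v ≤ K.dist y z + K.w z v :=
            (K.dist_triangle y z v).trans (by gcongr; exact WDigraph.dist_le_weight hzK hvK)
        _ ≤ K.dist y z + ((G.incident B).dist z u + (G.incident B).w u v) := by
            gcongr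
            exact h3.trans (WDigraph.dist_le_dist_add_weight (incident_adj.2 ⟨haG, Or.inl huB⟩))
        _ ≤ ℓ + (G.del x).w u v := by
            rw [← add_assoc, incident_w (Or.inl huB)]
            gcongr
            exact le_rfl

/-- The edges of `F₂` preserve, up to a factor, the lengths of the detours that end on `P` after
`x`. -/
theorem dist_graph₁_le_of_detour (hT : T.IsShortestPathTree G s)
    (hAB : T.IsCentroidBipartition z A B) (hε : 0 ≤ ε₂)
    (hupd : ∀ i ≤ levels (T.rootPath z), IsProgMainOutput G T (T.rootPath z) ε₂ i (upd i))
    {x b y : V} {ℓ : ℝ≥0∞} (hx : x ∈ T.rootPath z) (hxs : x ≠ s) (hb : b ∈ T.rootPath z)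
    (hbx : T.depth b < T.depth x) (hy : y ∈ T.rootPath z) (hxy : T.depth x < T.depth y)
    (h : Detour G (T.rootPath z) b y ℓ) :
    ((graph₁ G T z A B upd).del x).dist s y ≤
      ENNReal.ofReal (1 + ε₂) ^ levels (T.rootPath z) * (G.dist s b + ℓ) := by
  set K := (graph₁ G T z A B upd).del x with hK
  have hz := hAB.subset_left hAB.mem_left
  have hPT : ∀ v ∈ T.rootPath z, v ∈ T.verts := fun v hv => mem_verts_of_mem_rootPath hz hv
  have hPA : ∀ v ∈ T.rootPath z, v ∈ A := fun v hv =>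
    hAB.mem_left_of_isAncestor hAB.mem_left ((RootedTree.mem_rootPath hz).1 hv)
  have hsA : s ∈ A := hT.root_eq ▸ hAB.root_mem
  obtain ⟨i, hi, hle⟩ := exists_valueBefore_le_of_depth_lt hT hz hε hupd hx hb hbx h fun _ => hxy
  refine le_trans ?_ hle
  have hfin := ne_top_of_le_ne_top (ENNReal.mul_ne_top (ENNReal.pow_ne_top ENNReal.ofReal_ne_top)
    (ENNReal.add_ne_top.2 ⟨hT.dist_ne_top (hPT b hb), h.walk.ne_top⟩)) hle
  obtain ⟨j, hj, β, he⟩ := exists_entry_of_valueBefore_ne_top hfin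
  obtain ⟨b', rfl, hb', ⟨ℓ', -, hval⟩, -⟩ := (hupd i hi).entrySound hT hε hPT he
  rw [← hb'.2, intervalIndex_rootPath hz hb'.1, intervalIndex_rootPath hz hx] at hj
  have hb'x := lt_of_div_lt_div hj
  have hne : ∀ w, T.IsAncestor w b' → w ≠ x := by
    rintro w hw rfl
    exact absurd hw.depth_le (not_le.2 hb'x)
  have hb'T := hPT b' hb'.1
  have h1 := hT.dist_add_dist_le (hT.root_eq ▸ RootedTree.isAncestor_root hb'T) K
    (Finset.mem_erase.2 ⟨hxs.symm, hsA⟩) fun w _ _ _ hwb => ⟨Finset.mem_erase.2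
      ⟨hne w hwb, hAB.mem_left_of_isAncestor (hPA b' hb'.1) hwb⟩, graph₁_w_le _ _⟩
  have hb'y : b' ≠ y := by
    rintro rfl
    omega
  have hyx : y ≠ x := by
    rintro rfl
    omega
  have h2 : K.w b' y ≤
      valueBefore (upd i (some y)) (intervalIndex (T.rootPath z) i ((T.rootPath z).idxOf x)) -
        G.dist s b' := by
    refine ((min_le_right _ _).trans (min_le_right _ _)).trans ?_
    rw [weightF₂, if_pos ⟨hy, hb'y⟩, ← hT.treeDist_eq b', ← hT.root_eq]
    exact iInf₂_le_of_le i hi (iInf_le_of_le j (iInf_le_of_le _ (iInf_le _ he)))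
  calc K.dist s y ≤ K.dist s b' + K.w b' y := (K.dist_triangle s b' y).trans (by
          gcongr
          exact WDigraph.dist_le_weight
            (Finset.mem_erase.2 ⟨hne b' (RootedTree.IsAncestor.refl hb'T), hPA b' hb'.1⟩)
            (Finset.mem_erase.2 ⟨hyx, hPA y hy⟩))
    _ ≤ G.dist s b' + _ := add_le_add (le_add_self.trans h1) h2
    _ = _ := add_tsub_cancel_of_le (hval ▸ le_self_add)

end Recursion

end

section

variable {V : Type u} [DecidableEq V]

/-! ### The size of the graphs of the recursion -/

theorem RootedTree.depth_lt_card {V : Type u} {T : RootedTree V} {z : V} (hz : z ∈ T.verts) :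
    T.depth z < T.verts.card := by
  have h := Finset.card_le_card_of_injOn (s := Finset.range (T.depth z + 1)) (t := T.verts)
    (fun k => T.parent^[k] z) (fun k _ => RootedTree.iterate_mem hz k) (by
      intro k hk m hm hkm
      rw [Finset.mem_coe, Finset.mem_range, Nat.lt_succ_iff] at hk hm
      have h1 := RootedTree.depth_iterate hz hk
      have h2 := RootedTree.depth_iterate hz hm
      simp only at hkm
      rw [hkm] at h1
      omega)
  rwa [Finset.card_range] at h

theorem card_graph₂_le {G : WDigraph V} {T : RootedTree V} {s z : V} {A B : Finset V}
    (hAB : T.IsCentroidBipartition z A B) : (graph₂ G s z A B).verts.card ≤ B.card := by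
  have h1 := Finset.card_insert_le s (B.erase z)
  rwa [Finset.card_erase_add_one hAB.mem_right] at h1

/-- Two levels of the recursion halve the number of vertices, reduced by one. -/
theorem sq_le_of_three_mul_le {a n k : ℕ} (ha : 3 * a ≤ 2 * n + 1)
    (hk : (n - 1) ^ 2 ≤ 25 * 2 ^ (k + 1)) : (a - 1) ^ 2 ≤ 25 * 2 ^ k := by
  have h1 : 3 * (a - 1) ≤ 2 * (n - 1) := by omega
  have h2 := Nat.pow_le_pow_left h1 2
  rw [mul_pow, mul_pow] at h2
  rw [pow_succ 2] at hk
  omega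

/-! ### The query -/

/-- The error of the query grows by a factor of at most `1 + ε₁` with each level of the recursion. The
hypothesis `hk` bounds by `k` the number of levels above the leaves: it fails for `k = 0` if the graph
has more than `6` vertices. -/
theorem Oracle.query_bounds {s : V} {ε₁ ε₂ : ℝ} {n : ℕ} (h₁ : 0 ≤ ε₁) (h₂ : 0 ≤ ε₂)
    (hn : 6 < n → ENNReal.ofReal (1 + ε₂) ^ Nat.clog 2 n ≤ ENNReal.ofReal (1 + ε₁))
    {G : WDigraph V} (O : Oracle s ε₁ ε₂ G) (hGn : G.verts.card ≤ n) {k : ℕ}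
    (hk : (G.verts.card - 1) ^ 2 ≤ 25 * 2 ^ k) {x t : V} (hx : x ∈ G.verts) (hxs : x ≠ s)
    (htx : t ≠ x) :
    (G.del x).dist s t ≤ O.query x t ∧
      O.query x t ≤ ENNReal.ofReal (1 + ε₁) ^ k * (G.del x).dist s t := by
  have hone₁ := one_le_ofReal h₁
  have hone₂ := one_le_ofReal h₂
  have hself : ∀ (k : ℕ) (a : ℝ≥0∞), a ≤ ENNReal.ofReal (1 + ε₁) ^ k * a := fun k a =>
    le_mul_of_one_le_left' (one_le_pow₀ hone₁)
  induction O generalizing k with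
  | leaf G T hT _ =>
    rw [Oracle.query]
    split_ifs with hanc
    · exact ⟨le_rfl, hself _ _⟩
    · rw [hT.treeDist_eq, hT.dist_del_eq hanc]
      exact ⟨le_rfl, hself _ _⟩
  | node G T hT hsize z A B hAB upd hupd dhat hdhat O₁ O₂ ih₁ ih₂ =>
    rw [Oracle.query]
    by_cases hanc : T.IsAncestor x t
    swap
    · rw [if_pos hanc, hT.treeDist_eq, hT.dist_del_eq hanc]
      exact ⟨le_rfl, hself _ _⟩
    rw [if_neg (not_not.2 hanc)]
    have hz := hAB.subset_left hAB.mem_left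
    have hsA : s ∈ A := hT.root_eq ▸ hAB.root_mem
    have hTG := Finset.card_le_card hT.subset_verts
    have hxt := hanc.depth_lt htx.symm
    have hts : t ≠ s := by
      intro e
      rw [e, ← hT.root_eq, RootedTree.depth_root] at hxt
      omega
    have htP : t ∈ T.rootPath z → T.depth x < T.depth t := fun _ => hxt
    have hlevels : ENNReal.ofReal (1 + ε₂) ^ levels (T.rootPath z) ≤ ENNReal.ofReal (1 + ε₁) := by
      refine le_trans (pow_le_pow_right₀ hone₂ (Nat.clog_mono_right 2 ?_)) (hn (by omega))
      rw [RootedTree.length_rootPath]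
      have := RootedTree.depth_lt_card hz
      omega
    obtain ⟨k, rfl⟩ : ∃ m, k = m + 1 := by
      refine Nat.exists_eq_succ_of_ne_zero fun h0 => ?_
      subst h0
      have : 6 ^ 2 ≤ (G.verts.card - 1) ^ 2 := Nat.pow_le_pow_left (by omega) 2
      omega
    have hA : (graph₁ G T z A B upd).verts = A := rfl
    have hB : (graph₂ G s z A B).verts = insert s (B.erase z) := rfl
    have hcB := card_graph₂_le (G := G) (s := s) hAB
    have hlA := hAB.left_upper
    have hlB := hAB.right_upper
    have hkA : ((graph₁ G T z A B upd).verts.card - 1) ^ 2 ≤ 25 * 2 ^ k :=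
      sq_le_of_three_mul_le (by rw [hA]; omega) hk
    have hkB : ((graph₂ G s z A B).verts.card - 1) ^ 2 ≤ 25 * 2 ^ k :=
      sq_le_of_three_mul_le (by omega) hk
    have hdp := dist_del_le_dpQuery (x := x) hT hz h₂ hupd htx
    have hC0 : ∀ k, ENNReal.ofReal (1 + ε₁) ^ k ≠ 0 := fun k =>
      (zero_lt_one.trans_le (one_le_pow₀ hone₁)).ne'
    have hCk : ENNReal.ofReal (1 + ε₁) ≤ ENNReal.ofReal (1 + ε₁) ^ (k + 1) := by
      simpa using pow_le_pow_right₀ hone₁ (Nat.succ_le_succ (Nat.zero_le k))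
    by_cases h3 : x ∈ T.rootPath z ∧ t ∈ (graph₂ G s z A B).verts
    · rw [if_pos h3]
      obtain ⟨hxP, ht2⟩ := h3
      rw [hB] at ht2
      have htB : t ∈ B := Finset.mem_of_mem_erase ((Finset.mem_insert.1 ht2).resolve_left hts)
      have hzt := hAB.isAncestor_right htB
      have hxz := (RootedTree.mem_rootPath hz).1 hxP
      have htree := hT.dist_add_treeDist hzt
      refine ⟨le_min hdp ?_, ?_⟩
      · by_cases hxz' : x = z
        · subst hxz'
          have : (G.del x).dist s x = ⊤ := by
            by_contra h
            exact (Finset.mem_erase.1 (WDigraph.mem_right_of_dist_ne_top h)).1 rfl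
          have h4 := (hdhat x hx hxs).1
          rw [this, top_le_iff] at h4
          simp [h4]
        · have h4 := hT.dist_add_dist_del_le (x := x) hzt fun h => by
            have := h.1.depth_le
            have := hxz.depth_lt hxz'
            omega
          rw [← htree, ENNReal.add_le_add_iff_left (hT.dist_ne_top hz)] at h4
          exact ((G.del x).dist_triangle s z t).trans (add_le_add (hdhat x hx hxs).1 h4)
      · refine WDigraph.le_mul_dist (hC0 _) fun ℓ hw => ?_
        obtain ⟨b, hb, hbx, ⟨ℓ', hd, hle, -⟩ | ⟨y, hy, hxy, ℓ₁, ℓ₂, hd, hw₂, hle⟩⟩ :=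
          walk_del_decomposition hT hz hxP hxs hw
        · refine (min_le_left _ _).trans ((dpQuery_le hT hz h₂ hupd hxP hb hbx hd htP).trans ?_)
          gcongr ?_ * ?_
          exact hlevels.trans hCk
        · -- the replacement path returns to `P` after `x`, so that it can be assumed to contain `z`
          have hyz := (RootedTree.mem_rootPath hz).1 hy
          have hyfin := hT.dist_ne_top hyz.mem_left
          have h4 := hT.dist_add_dist_del_le (x := x) hyz fun h => by
            have := h.1.depth_le
            omega
          have h5 := hd.dist_del_le hT hxP hbx (fun e => by simp [e] at hxy)
          have h6 : G.dist y t ≤ ℓ₂ :=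
            (G.dist_le_dist_del x y t).trans (WDigraph.dist_le_of_walk hw₂)
          have h7 : (G.del x).dist y z + T.dist G z t ≤ ℓ₂ := by
            rw [← ENNReal.add_le_add_iff_left hyfin, ← add_assoc]
            calc _ ≤ G.dist s z + T.dist G z t := by gcongr
              _ = G.dist s t := htree
              _ ≤ G.dist s y + ℓ₂ := (G.dist_triangle s y t).trans (by gcongr)
          calc _ ≤ dhat x + T.dist G z t := min_le_right _ _
            _ ≤ ENNReal.ofReal (1 + ε₁) * (G.del x).dist s z + T.dist G z t := by
                gcongr
                exact (hdhat x hx hxs).2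
            _ ≤ ENNReal.ofReal (1 + ε₁) * ((G.del x).dist s z + T.dist G z t) := by
                rw [mul_add]
                gcongr
                exact le_mul_of_one_le_left' hone₁
            _ ≤ ENNReal.ofReal (1 + ε₁) ^ (k + 1) * ℓ := by
                gcongr
                refine le_trans ?_ hle
                calc _ ≤ (G.del x).dist s y + (G.del x).dist y z + T.dist G z t := by
                      gcongr
                      exact (G.del x).dist_triangle s y z
                  _ ≤ _ := by
                      rw [add_assoc]
                      exact add_le_add h5 h7
    rw [if_neg h3]
    by_cases h4 : x ∈ (graph₁ G T z A B upd).verts ∧ t ∈ (graph₁ G T z A B upd).verts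
    · rw [if_pos h4]
      obtain ⟨hxA, htA⟩ := h4
      obtain ⟨hlo, hhi⟩ := ih₁ (by rw [hA]; omega) hkA hxA
      refine ⟨le_min ((dist_del_le_dist_graph₁ hT hAB h₂ hupd hxA hxs).trans hlo) hdp, ?_⟩
      refine WDigraph.le_mul_dist (hC0 _) fun ℓ hw => ?_
      by_cases hxP : x ∈ T.rootPath z
      · obtain ⟨b, hb, hbx, ⟨ℓ', hd, hle, -⟩ | ⟨y, hy, hxy, ℓ₁, ℓ₂, hd, hw₂, hle⟩⟩ :=
          walk_del_decomposition hT hz hxP hxs hw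
        · refine (min_le_right _ _).trans ((dpQuery_le hT hz h₂ hupd hxP hb hbx hd htP).trans ?_)
          gcongr ?_ * ?_
          exact hlevels.trans hCk
        · have h5 := dist_graph₁_le_of_detour hT hAB h₂ hupd hxP hxs hb hbx hy hxy hd
          have h6 := dist_graph₁_le (upd := upd) hT hAB ((RootedTree.mem_rootPath hz).1 hy)
            (fun h => by have := h.1.depth_le; omega) hw₂ htA
          refine (min_le_left _ _).trans (hhi.trans ?_)
          rw [pow_succ, mul_assoc]
          gcongr
          calc _ ≤ _ := WDigraph.dist_triangle _ s y t
            _ ≤ ENNReal.ofReal (1 + ε₁) * (G.dist s b + ℓ₁) + ENNReal.ofReal (1 + ε₁) * ℓ₂ := by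
                refine add_le_add (h5.trans (by gcongr)) (h6.trans ?_)
                exact le_mul_of_one_le_left' hone₁
            _ ≤ ENNReal.ofReal (1 + ε₁) * ℓ := by
                rw [← mul_add]
                gcongr
      · refine (min_le_left _ _).trans (hhi.trans ?_)
        have h5 := dist_graph₁_le (upd := upd) hT hAB (hT.root_eq ▸ RootedTree.isAncestor_root hz)
          (fun h => hxP ((RootedTree.mem_rootPath hz).2 h.2)) hw htA
        gcongr
        exact Nat.le_succ k
    rw [if_neg h4]
    -- only the case that both vertices are below `z` in `T₂` is left
    have hxB : x ∈ B ∧ x ≠ z := by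
      by_contra hc
      have hxA : x ∈ A := by
        rcases hAB.mem_or_mem hanc.mem_left with h | h
        · exact h
        · exact (not_not.1 fun hne => hc ⟨h, hne⟩ : x = z) ▸ hAB.mem_left
      have htA : t ∉ A := fun h => h4 ⟨hxA, h⟩
      have htB := (hAB.mem_or_mem hanc.1).resolve_left htA
      have htz : t ≠ z := fun e => htA (e ▸ hAB.mem_left)
      refine h3 ⟨(RootedTree.mem_rootPath hz).2 ?_,
        Finset.mem_insert_of_mem (Finset.mem_erase.2 ⟨htz, htB⟩)⟩
      rcases le_total (T.depth x) (T.depth z) with h | h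
      · exact hanc.of_depth_le (hAB.isAncestor_right htB) h
      · have hzx := (hAB.isAncestor_right htB).of_depth_le hanc h
        have := hAB.eq_of_mem hxA (hAB.mem_right_of_isAncestor hzx hanc htB)
        exact this ▸ RootedTree.IsAncestor.refl hanc.mem_left
    have htB : t ∈ B.erase z := by
      have hxA : x ∉ A := fun h => hxB.2 (hAB.eq_of_mem h hxB.1)
      have htA : t ∉ A := fun h => hxA (hAB.mem_left_of_isAncestor h hanc)
      exact Finset.mem_erase.2 ⟨fun e => htA (e ▸ hAB.mem_left),
        (hAB.mem_or_mem hanc.1).resolve_left htA⟩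
    have hx2 : x ∈ (graph₂ G s z A B).verts :=
      Finset.mem_insert_of_mem (Finset.mem_erase.2 ⟨hxB.2, hxB.1⟩)
    rw [if_pos ⟨hx2, Finset.mem_insert_of_mem htB⟩]
    obtain ⟨hlo, hhi⟩ := ih₂ (by omega) hkB hx2
    refine ⟨(dist_del_le_dist_graph₂ hT hAB hxB.1 hxB.2).trans hlo, ?_⟩
    refine WDigraph.le_mul_dist (hC0 _) fun ℓ hw => hhi.trans ?_
    have h5 := dist_graph₂_le hT hAB hw hxB.1 hxB.2 htB
    gcongr
    exact Nat.le_succ k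

/-- The construction can be carried out. -/
theorem Oracle.nonempty {s : V} {ε₁ ε₂ : ℝ} (h₁ : 0 ≤ ε₁) (h₂ : 0 ≤ ε₂) (G : WDigraph V)
    (hs : s ∈ G.verts) : Nonempty (Oracle s ε₁ ε₂ G) := by
  induction hc : G.verts.card using Nat.strong_induction_on generalizing G with
  | _ n ih =>
    obtain ⟨T, hT⟩ := RootedTree.exists_isShortestPathTree G hs
    by_cases hsize : T.verts.card ≤ 6
    · exact ⟨.leaf G T hT hsize⟩
    obtain ⟨z, A, B, hAB⟩ := T.exists_isCentroidBipartition (not_le.1 hsize)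
    choose upd hupd using exists_isProgMainOutput G T (T.rootPath z) h₂
    have hTG := Finset.card_le_card hT.subset_verts
    have hlA := hAB.left_upper
    have hlB := hAB.right_upper
    have hcB := card_graph₂_le (G := G) (s := s) hAB
    have hcA : (graph₁ G T z A B upd).verts.card = A.card := rfl
    obtain ⟨O₁⟩ := ih _ (by omega) (graph₁ G T z A B upd) (hT.root_eq ▸ hAB.root_mem) rfl
    obtain ⟨O₂⟩ := ih _ (by omega) (graph₂ G s z A B) (Finset.mem_insert_self _ _) rfl
    exact ⟨.node G T hT (not_le.1 hsize) z A B hAB upd (fun i _ => hupd i)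
      (fun x => (G.del x).dist s z)
      (fun x _ _ => ⟨le_rfl, le_mul_of_one_le_left' (one_le_ofReal h₁)⟩) O₁ O₂⟩

/-! ### The choice of the parameters -/

theorem one_add_pow_le_exp {a : ℝ} (ha : 0 ≤ a) (k : ℕ) : (1 + a) ^ k ≤ Real.exp (k * a) := by
  rw [Real.exp_nat_mul]
  gcongr
  rw [add_comm]
  exact Real.add_one_le_exp a

theorem exp_le_one_add_mul {y : ℝ} (h0 : 0 ≤ y) (h1 : y ≤ 2 / 3) : Real.exp y ≤ 1 + 3 / 2 * y := by
  have h := Real.exp_bound' h0 (by linarith) (n := 3) (by norm_num)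
  norm_num [Finset.sum_range_succ, Nat.factorial] at h
  nlinarith [mul_nonneg h0 (sub_nonneg.2 h1), mul_nonneg (mul_nonneg h0 h0) (sub_nonneg.2 h1)]

theorem exp_le_one_add_four_thirds_mul {y : ℝ} (h0 : 0 ≤ y) (h1 : y ≤ 1 / 3) :
    Real.exp y ≤ 1 + 4 / 3 * y := by
  have h := Real.abs_exp_sub_one_sub_id_le (x := y) (by rw [abs_of_nonneg h0]; linarith)
  have := (abs_le.1 h).2
  nlinarith

/-- The `2 * Nat.log 2 n` levels of the recursion cost a factor of `1 + ε`. -/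
theorem one_add_pow_log_le {ε ε₁ : ℝ} {n : ℕ} (hε : 0 < ε) (hε' : ε ≤ 1)
    (hε₁ : ε₁ = ε / (3 * Real.logb 2 n)) (h₁ : 0 ≤ ε₁) : (1 + ε₁) ^ (2 * Nat.log 2 n) ≤ 1 + ε := by
  have hlog : (Nat.log 2 n : ℝ) ≤ Real.logb 2 n := by
    simpa using Real.natLog_le_logb n 2
  have hy : ((2 * Nat.log 2 n : ℕ) : ℝ) * ε₁ ≤ 2 / 3 * ε := by
    push_cast
    rcases eq_or_ne (Real.logb 2 n) 0 with h0 | h0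
    · rw [hε₁, h0]
      simp
      exact hε.le
    · calc 2 * (Nat.log 2 n : ℝ) * ε₁ ≤ 2 * Real.logb 2 n * ε₁ := by gcongr
        _ = 2 / 3 * ε := by rw [hε₁]; field_simp
  refine (one_add_pow_le_exp h₁ _).trans ((Real.exp_le_exp.2 hy).trans ?_)
  have := exp_le_one_add_mul (y := 2 / 3 * ε) (by linarith) (by linarith)
  linarith

/-- The levels of the subdivision of a path cost a factor of `1 + ε₁`. -/
theorem one_add_pow_clog_le {ε ε₁ ε₂ : ℝ} {n : ℕ} (hε' : ε ≤ 1)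
    (hε₁ : ε₁ = ε / (3 * Real.logb 2 n)) (hε₂ : ε₂ = ε₁ / (2 * Real.logb 2 n)) (h₁ : 0 ≤ ε₁)
    (h₂ : 0 ≤ ε₂) (hn : 6 < n) : (1 + ε₂) ^ Nat.clog 2 n ≤ 1 + ε₁ := by
  have hlog : (Nat.log 2 n : ℝ) ≤ Real.logb 2 n := by
    simpa using Real.natLog_le_logb n 2
  have hlog2 : 2 ≤ Nat.log 2 n := (Nat.le_log_iff_pow_le (by norm_num) (by omega)).2 (by omega)
  have hlog2' : (2 : ℝ) ≤ Real.logb 2 n := le_trans (by exact_mod_cast hlog2) hlog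
  have hclog : Nat.clog 2 n ≤ Nat.log 2 n + 1 :=
    Nat.clog_le_of_le_pow (Nat.lt_pow_succ_log_self (by norm_num) n).le
  have hclog' : (Nat.clog 2 n : ℝ) ≤ 3 / 2 * Real.logb 2 n := by
    have : (Nat.clog 2 n : ℝ) ≤ Nat.log 2 n + 1 := by exact_mod_cast hclog
    linarith
  have hsmall : ε₁ ≤ 1 / 3 := by
    rw [hε₁, div_le_div_iff₀ (by linarith) (by norm_num)]
    linarith
  have hy : (Nat.clog 2 n : ℝ) * ε₂ ≤ 3 / 4 * ε₁ := by
    calc (Nat.clog 2 n : ℝ) * ε₂ ≤ 3 / 2 * Real.logb 2 n * ε₂ := by gcongr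
      _ = 3 / 4 * ε₁ := by rw [hε₂]; field_simp; ring
  refine (one_add_pow_le_exp h₂ _).trans ((Real.exp_le_exp.2 hy).trans ?_)
  have := exp_le_one_add_four_thirds_mul (y := 3 / 4 * ε₁) (by linarith) (by linarith)
  linarith

theorem sq_le_two_pow_log (n : ℕ) : (n - 1) ^ 2 ≤ 25 * 2 ^ (2 * Nat.log 2 n) := by
  have h1 := Nat.lt_pow_succ_log_self (b := 2) (by norm_num) n
  have h2 : n - 1 ≤ 2 * 2 ^ Nat.log 2 n := by
    rw [pow_succ] at h1
    omega
  have h3 := Nat.pow_le_pow_left h2 2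
  rw [mul_pow, ← pow_mul, mul_comm (Nat.log 2 n)] at h3
  omega

end

end FaultOracle

theorem mainTheorem2 {V : Type*} [DecidableEq V] (G : FaultOracle.WDigraph V) (s : V)
    (hs : s ∈ G.verts) (hw : ∀ u v, G.Adj u v → 0 < G.w u v)
    (ε ε₁ ε₂ : ℝ) (hε : 0 < ε) (hε' : ε ≤ 1)
    (hε₁ : ε₁ = ε / (3 * Real.logb 2 G.verts.card))
    (hε₂ : ε₂ = ε₁ / (2 * Real.logb 2 G.verts.card)) :
    Nonempty (FaultOracle.Oracle s ε₁ ε₂ G) ∧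
      ∀ O : FaultOracle.Oracle s ε₁ ε₂ G,
        ∀ x ∈ G.verts, x ≠ s → ∀ t ∈ G.verts, t ≠ x →
          (G.del x).dist s t ≤ O.query x t ∧
            O.query x t ≤ ENNReal.ofReal (1 + ε) * (G.del x).dist s t := by
  have hlog : 0 ≤ Real.logb 2 G.verts.card := Real.logb_nonneg (by norm_num)
    (by exact_mod_cast Finset.card_pos.2 ⟨s, hs⟩)
  have h₁ : 0 ≤ ε₁ := by rw [hε₁]; positivity
  have h₂ : 0 ≤ ε₂ := by rw [hε₂]; positivity
  refine ⟨FaultOracle.Oracle.nonempty h₁ h₂ G hs, fun O x hx hxs t _ htx => ?_⟩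
  have hn : 6 < G.verts.card → ENNReal.ofReal (1 + ε₂) ^ Nat.clog 2 G.verts.card ≤
      ENNReal.ofReal (1 + ε₁) := fun hn => by
    rw [← ENNReal.ofReal_pow (by linarith)]
    exact ENNReal.ofReal_le_ofReal (FaultOracle.one_add_pow_clog_le hε' hε₁ hε₂ h₁ h₂ hn)
  obtain ⟨hlo, hhi⟩ := O.query_bounds h₁ h₂ hn le_rfl
    (FaultOracle.sq_le_two_pow_log G.verts.card) hx hxs htx
  refine ⟨hlo, hhi.trans ?_⟩
  gcongr
  rw [← ENNReal.ofReal_pow (by linarith)]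
  exact ENNReal.ofReal_le_ofReal (FaultOracle.one_add_pow_log_le hε hε' hε₁ h₁)
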